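/- Let $\mathcal G=(\mathcal V,\mathcal E)$ be a finite acyclic directed multigraph with a source $s$ and a set $\mathcal T\subseteq \mathcal V\setminus\{s\}$ of sinks, each link carrying one packet, let $R\ge 1$ be an integer such that the min-cut from $s$ to every sink is at least $R$, and let $\varepsilon>0$. The source multicasts $R$ messages $X_1,\dots,X_R$, with all arithmetic over the field $\mathbb F_2(z)$ of rational functions. *Virtual graph.* Call the $R$ messages, which enter at $s$, together with the links, the ports; a link $e$ enters its head. Replace every node $v$ by a gadget. Each port entering $v$ gets a binary tree (every node has at most two children), entered at its root, whose leaves are labelled bijectively by the outgoing links of $v$ and one extra spare label. Each outgoing link $e$ of $v$ gets an inverted binary tree, from whose root $e$ leaves, whose leaves are labelled bijectively by the ports entering $v$ and one extra spare label. For each port $p$ entering $v$ and each outgoing link $e$ of $v$, an edge joins the leaf labelled $e$ of the tree of $p$ to the leaf labelled $p$ of the inverted tree of $e$. The shapes of the trees are arbitrary. The roots of the trees of the $R$ messages are the $R$ copies of the source; the depth $\Delta(v)$ of a node $v$ of the virtual graph is the length of a shortest directed path from a copy of the source to $v$. *The code $\mathrm{SUP}(\varepsilon)$.* The $i$-th copy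 of the source sends $X_i$ on its outgoing edges. A node with one incoming edge broadcasts the packet it receives on all its outgoing edges (a spare node without incoming edge sends $0$). A node with two incoming edges (a coding node) sends $\beta Y+\beta' Y'$, where $Y,Y'$ are its incoming packets. The coefficients $\beta,\beta'$ of all coding nodes are drawn independently, those of a coding node $v$ uniformly from the set of polynomials in $\mathbb F_2[z]$ of degree at most $$\Big\lceil (R+1)\big(\Delta(v)+1+\log_2 R\big)+\Delta(v)+\log_2(1/\varepsilon)-1\Big\rceil$$ (only the zero polynomial if this number is negative). In particular, these sets depend on the network only through $R$ and $\Delta(v)$. (The depth of a coding node which cannot be reached from the source is irrelevant and is set to $0$.) Then the overall error probability is at most $\varepsilon$: with probability at least $1-\varepsilon$, for all sinks $t\in\mathcal T$ simultaneously, the transfer matrix over $\mathbb F_2(z)$ from $(X_1,\dots,X_R)$ to the packets on the links entering $t$ is left invertible, so that every sink can recover all $R$ messages. -/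

import Mathlib

open scoped Polynomial ENNReal

/-! ### Directed multigraphs -/

/-- A directed multigraph with nodes `V` and edges `E`; the edge `e` goes from `tail e` to
`head e`. -/
structure MultiDigraph (V E : Type*) where
  tail : E → V
  head : E → V

namespace MultiDigraph

variable {V E : Type*} (G : MultiDigraph V E)

/-- There is an edge from `u` to `v`. -/
def Adj (u v : V) : Prop := ∃ e, G.tail e = u ∧ G.head e = v

/-- There is no directed cycle. -/
def Acyclic : Prop := ∀ v, ¬ Relation.TransGen G.Adj v v

/-- The edges that leave the set `A` of nodes. -/
def cut (A : Set V) : Set E := {e | G.tail e ∈ A ∧ G.head e ∉ A}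

/-- The min-cut from `s` to `t`: the least number of edges leaving a set of nodes which contains
`s` and not `t`. -/
noncomputable def minCut (s t : V) : ℕ∞ :=
  ⨅ (A : Set V) (_ : s ∈ A ∧ t ∉ A), (G.cut A).encard

/-- A node with two incoming edges. -/
def IsCodingNode (v : V) : Prop := {e | G.head e = v}.ncard = 2

/-- There is a directed walk with exactly `n` edges from `u` to `v`. -/
def HasWalk (n : ℕ) (u v : V) : Prop :=
  ∃ p : ℕ → V, p 0 = u ∧ p n = v ∧ ∀ k < n, G.Adj (p k) (p (k + 1))

/-- The depth of a node: the length of a shortest directed path to it from the set `S` (copies of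
the source). It is `0` by convention for a node that cannot be reached from `S`. -/
noncomputable def depth (S : Set V) (v : V) : ℕ := sInf {n | ∃ s ∈ S, G.HasWalk n s v}

open Classical in
/-- The packets `Y e` on the edges obey the linear operations of the nodes: a node multiplies the
packet of each incoming edge `e'` by `c e'`, adds up, and sends the sum on each outgoing edge.
The node `src i` moreover injects the message `X i`. -/
def IsPackets {ι K : Type*} [Fintype ι] [Fintype E] [Field K]
    (src : ι → V) (c : E → K) (X : ι → K) (Y : E → K) : Prop :=
  ∀ e, Y e = (∑ i, if src i = G.tail e then X i else 0) +
    ∑ e', if G.head e' = G.tail e then c e' * Y e' else 0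

variable {G}

theorem Acyclic.wellFounded [Finite E] (h : G.Acyclic) :
    WellFounded (fun e' e : E => G.head e' = G.tail e) := by
  have key : ∀ a b, Relation.TransGen (fun e' e : E => G.head e' = G.tail e) a b →
      Relation.TransGen G.Adj (G.tail a) (G.tail b) := by
    intro a b hab
    induction hab with
    | single hb => exact .single ⟨a, rfl, hb⟩
    | tail _ hb ih => exact ih.tail ⟨_, rfl, hb⟩
  have : Std.Irrefl (Relation.TransGen (fun e' e : E => G.head e' = G.tail e)) :=
    ⟨fun a ha => h _ (key a a ha)⟩
  have := Finite.wellFounded_of_trans_of_irrefl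
    (Relation.TransGen (fun e' e : E => G.head e' = G.tail e))
  exact WellFounded.mono this fun _ _ hab => Relation.TransGen.single hab

theorem Acyclic.existsUnique_isPackets {ι K : Type*} [Fintype ι] [Fintype E] [Field K]
    (h : G.Acyclic) (src : ι → V) (c : E → K) (X : ι → K) :
    ∃! Y : E → K, G.IsPackets src c X Y := by
  classical
  refine ⟨h.wellFounded.fix fun e Y => (∑ i, if src i = G.tail e then X i else 0) +
    ∑ e', if he : G.head e' = G.tail e then c e' * Y e' he else 0, ?_, ?_⟩
  · intro e
    rw [WellFounded.fix_eq]
    simp only [dite_eq_ite]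
  · intro Y hY
    funext e
    induction e using h.wellFounded.induction with
    | _ e ih =>
      rw [hY e, WellFounded.fix_eq]
      refine congrArg₂ (· + ·) rfl (Finset.sum_congr rfl fun e' _ => ?_)
      by_cases he : G.head e' = G.tail e
      · simp only [he, if_true, dif_pos, ih e' he]
      · simp only [he, if_false, dif_neg, not_false_eq_true]

/-- The packets on the edges of an acyclic graph when the messages are `X`. -/
noncomputable def packets {ι K : Type*} [Fintype ι] [Fintype E] [Field K]
    (h : G.Acyclic) (src : ι → V) (c : E → K) (X : ι → K) : E → K :=
  (h.existsUnique_isPackets src c X).choose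

/-- A strictly increasing numbering of the nodes of a finite acyclic graph. -/
theorem Acyclic.exists_rank [Finite V] (h : G.Acyclic) :
    ∃ τ : V → ℕ, ∀ u v, G.Adj u v → τ u < τ v := by
  refine ⟨fun v => {u | Relation.TransGen G.Adj u v}.ncard, fun u v huv => ?_⟩
  refine Set.ncard_lt_ncard ⟨fun w hw => ?_, fun hsub => ?_⟩ (Set.toFinite _)
  · exact Relation.TransGen.tail hw huv
  · exact h u (hsub (Relation.TransGen.single huv))

theorem acyclic_of_rank {α : Type*} [Preorder α] (f : V → α)
    (hf : ∀ e, f (G.tail e) < f (G.head e)) : G.Acyclic := by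
  have key : ∀ u v, Relation.TransGen G.Adj u v → f u < f v := by
    intro u v huv
    induction huv with
    | single hb => obtain ⟨e, rfl, rfl⟩ := hb; exact hf e
    | tail _ hb ih => obtain ⟨e, rfl, rfl⟩ := hb; exact ih.trans (hf e)
  exact fun v hv => lt_irrefl _ (key v v hv)

end MultiDigraph

/-! ### Multicast networks -/

/-- A single-source multicast network: an acyclic directed multigraph (each edge is a link that
carries one packet), a source node and a set of sinks. -/
structure Network (V E : Type*) extends MultiDigraph V E where
  source : V
  sinks : Set V
  acyclic : toMultiDigraph.Acyclic
  source_notMem_sinks : source ∉ sinks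

/-- The capacity of a network: the minimum over the sinks of the min-cut from the source. -/
noncomputable def Network.capacity {V E : Type*} (N : Network V E) : ℕ∞ :=
  ⨅ t ∈ N.sinks, N.minCut N.source t

/-- The node which the input port `p` enters: an input port is either one of the `R` messages,
which enter the network at the source, or a link of the network. -/
def Network.portHead {V E : Type*} (N : Network V E) {R : ℕ} : Fin R ⊕ E → V
  | .inl _ => N.source
  | .inr e => N.head e

/-! ### The virtual graph -/

/-- A finite rooted binary tree (every node has at most two children) whose leaves (the nodes
without children) are labelled bijectively by `L`. -/
structure BinTree (L : Type*) where
  Node : Type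
  finite : Finite Node
  root : Node
  parent : {x : Node // x ≠ root} → Node
  /-- The distance from the root. -/
  level : Node → ℕ
  level_root : level root = 0
  level_parent : ∀ x, level x.1 = level (parent x) + 1
  binary : ∀ x, {y | parent y = x}.ncard ≤ 2
  leaf : L ≃ {x : Node // ∀ y, parent y ≠ x}

instance {L : Type*} (T : BinTree L) : Finite T.Node := T.finite

/-- A choice of gadgets for the nodes of a network that carries `R` messages. An input port of a
node has a binary tree with one leaf for each outgoing link of that node and one further leaf
`none` (the spare "virtual node"). An outgoing link of a node has an (inverted) binary tree with
one leaf for each input port of that node and one further leaf `none`. -/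
structure Gadgets {V E : Type*} (N : Network V E) (R : ℕ) where
  inTree : (p : Fin R ⊕ E) → BinTree (Option {e : E // N.tail e = N.portHead p})
  outTree : (e : E) → BinTree (Option {p : Fin R ⊕ E // N.portHead p = N.tail e})

namespace Gadgets

variable {V E : Type*} {N : Network V E} {R : ℕ} (Γ : Gadgets N R)

/-- The nodes of the virtual graph. -/
inductive Node
  | inn (p : Fin R ⊕ E) (x : (Γ.inTree p).Node)
  | out (e : E) (x : (Γ.outTree e).Node)

/-- The edges of the virtual graph: the links of the network, the edges of the binary trees of the
input ports and of the inverted binary trees of the outgoing links (both indexed by their lower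
end), and, inside the gadget of a node, one connecting edge for every pair of an input port
and an outgoing link. -/
inductive Edge
  | link (e : E)
  | down (p : Fin R ⊕ E) (x : {x : (Γ.inTree p).Node // x ≠ (Γ.inTree p).root})
  | up (e : E) (x : {x : (Γ.outTree e).Node // x ≠ (Γ.outTree e).root})
  | conn (p : Fin R ⊕ E) (e : E) (h : N.tail e = N.portHead p)

/-- The virtual graph: every link runs from the root of its inverted tree to the root of the
tree of its input port, and a connecting edge runs from a leaf of the tree of the input port to a
leaf of the inverted tree of the outgoing link. -/
def graph : MultiDigraph Γ.Node Γ.Edge where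
  tail
    | .link e => .out e (Γ.outTree e).root
    | .down p x => .inn p ((Γ.inTree p).parent x)
    | .up e x => .out e x
    | .conn p e h => .inn p ((Γ.inTree p).leaf (some ⟨e, h⟩))
  head
    | .link e => .inn (.inr e) (Γ.inTree (.inr e)).root
    | .down p x => .inn p x
    | .up e x => .out e ((Γ.outTree e).parent x)
    | .conn p e h => .out e ((Γ.outTree e).leaf (some ⟨p, h.symm⟩))

/-- The copy of the source that holds the message `i`. -/
def src (i : Fin R) : Γ.Node := .inn (.inl i) (Γ.inTree (.inl i)).root

instance [Finite E] : Finite Γ.Edge := by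
  let f : E ⊕ (Σ p, {x : (Γ.inTree p).Node // x ≠ (Γ.inTree p).root}) ⊕
      (Σ e, {x : (Γ.outTree e).Node // x ≠ (Γ.outTree e).root}) ⊕
      (Σ e, {p : Fin R ⊕ E // N.tail e = N.portHead p}) → Γ.Edge
    | .inl e => .link e
    | .inr (.inl ⟨p, x⟩) => .down p x
    | .inr (.inr (.inl ⟨e, x⟩)) => .up e x
    | .inr (.inr (.inr ⟨e, p⟩)) => .conn p.1 e p.2
  refine Finite.of_surjective f ?_
  rintro (e | ⟨p, x⟩ | ⟨e, x⟩ | ⟨p, e, h⟩)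
  · exact ⟨.inl e, rfl⟩
  · exact ⟨.inr (.inl ⟨p, x⟩), rfl⟩
  · exact ⟨.inr (.inr (.inl ⟨e, x⟩)), rfl⟩
  · exact ⟨.inr (.inr (.inr ⟨e, ⟨p, h⟩⟩)), rfl⟩

noncomputable instance [Finite E] : Fintype Γ.Edge := Fintype.ofFinite _

theorem acyclic_graph [Finite V] : Γ.graph.Acyclic := by
  obtain ⟨τ, hτ⟩ := N.acyclic.exists_rank
  let ρ : Fin R ⊕ E → ℕ := Sum.elim (fun _ => 0) (fun e => τ (N.tail e) + 1)
  have hρ : ∀ p e, N.tail e = N.portHead p → ρ p < ρ (.inr e) := by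
    rintro (i | e') e h
    · simp [ρ]
    · have := hτ _ _ ⟨e', rfl, h.symm⟩
      simpa [ρ] using this
  let f : Γ.Node → ℕ ×ₗ ℤ
    | .inn p x => toLex (2 * ρ p + 1, ((Γ.inTree p).level x : ℤ))
    | .out e x => toLex (2 * ρ (.inr e), -((Γ.outTree e).level x : ℤ))
  refine MultiDigraph.acyclic_of_rank f ?_
  rintro (e | ⟨p, x⟩ | ⟨e, x⟩ | ⟨p, e, h⟩)
  · simp [f, graph, Prod.Lex.toLex_lt_toLex]
  · simp [f, graph, Prod.Lex.toLex_lt_toLex, (Γ.inTree p).level_parent x]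
  · simp [f, graph, Prod.Lex.toLex_lt_toLex, (Γ.outTree e).level_parent x]
  · have := hρ p e h
    simp only [f, graph, Prod.Lex.toLex_lt_toLex]
    left
    omega

/-- The depth of a node of the virtual graph: its distance from the copies of the source. -/
noncomputable def depth (v : Γ.Node) : ℕ := Γ.graph.depth (Set.range Γ.src) v

end Gadgets

/-! ### The code -/

/-- The polynomials over `𝔽₂` of degree at most `d`; only the zero polynomial if `d < 0`. -/
noncomputable abbrev boundedPoly (d : ℤ) : Submodule (ZMod 2) (ZMod 2)[X] :=
  Polynomial.degreeLT (ZMod 2) (d + 1).toNat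

instance (d : ℤ) : Finite (boundedPoly d) :=
  Finite.of_equiv _ (Polynomial.degreeLTEquiv (ZMod 2) (d + 1).toNat).symm.toEquiv

/-- The bound, at a coding node of depth `Δ`, on the degree of the coding coefficients (the real
number is rounded up to an integer). -/
noncomputable def supDegree (ε : ℝ) (R Δ : ℕ) : ℤ :=
  ⌈((R : ℝ) + 1) * (Δ + 1 + Real.logb 2 R) + Δ + Real.logb 2 (1 / ε) - 1⌉

namespace Gadgets

variable {V E : Type*} {N : Network V E} {R : ℕ} (Γ : Gadgets N R)

/-- The choices of coding coefficients: one polynomial for each edge that enters a coding node,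
with the degree bound at the depth of that node. -/
abbrev SupChoice (ε : ℝ) : Type _ :=
  (e : {e : Γ.Edge // Γ.graph.IsCodingNode (Γ.graph.head e)}) →
    boundedPoly (supDegree ε R (Γ.depth (Γ.graph.head e)))

noncomputable instance [Finite E] (ε : ℝ) : Fintype (Γ.SupChoice ε) := Fintype.ofFinite _

variable {Γ}

open Classical in
/-- The factor by which the packet of the edge `e` is multiplied at the node it enters: the chosen
coefficient at a coding node, and `1` at every other node (broadcasting). -/
noncomputable def coeff {ε : ℝ} (ω : Γ.SupChoice ε) (e : Γ.Edge) : RatFunc (ZMod 2) :=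
  if h : Γ.graph.IsCodingNode (Γ.graph.head e) then
    algebraMap (ZMod 2)[X] (RatFunc (ZMod 2)) (ω ⟨e, h⟩ : (ZMod 2)[X])
  else 1

variable [Finite V] [Finite E]

/-- The transfer matrix from the source to `t`: its column `i` lists the packets on the links that
enter `t` when the message `i` is `1` and the other messages are `0`. -/
noncomputable def transferMatrix {ε : ℝ} (ω : Γ.SupChoice ε) (t : V) :
    Matrix {e : E // N.head e = t} (Fin R) (RatFunc (ZMod 2)) :=
  Matrix.of fun e i =>
    MultiDigraph.packets Γ.acyclic_graph Γ.src (coeff ω) (Pi.single i 1) (.link e)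

/-- Some transfer matrix to a sink is not (left) invertible, that is, some sink cannot recover the
messages: distinct messages can give it the same packets. -/
def IsError {ε : ℝ} (ω : Γ.SupChoice ε) : Prop :=
  ∃ t ∈ N.sinks, ¬ Function.Injective (transferMatrix ω t).mulVec

variable (Γ)

/-- The error probability when all coding coefficients are drawn independently and uniformly, that
is, when the choice is uniformly distributed on the finite product of the coefficient sets. -/
noncomputable def supErrorProb (ε : ℝ) : ℝ≥0∞ :=
  (PMF.uniformOfFintype (Γ.SupChoice ε)).toOuterMeasure {ω | IsError ω}

end Gadgets

/-! ### Encoding vectors and separating sets of nodes -/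

namespace MultiDigraph

variable {V E : Type*} (G : MultiDigraph V E)

/-! Every node of the virtual graph gets an encoding vector, and all in- and out-degrees there are
at most 2. Start with an independent variable as coefficient on every edge into a coding node, and
substitute the random polynomials node by node, in order of increasing depth. The invariant is that
every set `B` of nodes has a tight cut: some set separating `B` from the sources is no larger than
the rank of the vectors of `B`. At the end, a set separating the incoming links of a sink from the
copies of the source has at least `R` nodes (`Gadgets.le_card_of_not_reach`), so the rank is `R` and
the sink can decode.

The coefficient sets need not grow with the network because of `IsEncoding.hasTightCut`: when the
nodes of `P` have fixed coefficients and the other coding nodes generic ones, only subsets of `P`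
and its in-neighbours have to be checked. Relations between encoding vectors are combinations of
node equations (`IsEncoding.exists_comb_eq`). The equation of a generic node cannot contribute to
relations inside a subspace that misses one of its in-neighbours, as the automorphism adding 1 to a
single variable shows (`IsEncoding.coeff_eq_zero_of_generic`).

If fixing a node `v` of depth `Δ` destroys a tight cut, then `R` independent nodes become dependent,
chosen among the sources, the nodes fixed so far and their in-neighbours. There are at most `2 * (R
* 2 ^ (Δ + 1))` candidates (`ncard_window_le`). Independence of `R` given nodes is the nonvanishing
of a determinant that is affine in the coefficients at `v`, so it is lost with probability at most
`1 / q`, where `q` is the number of admissible polynomials (`card_dependent_mul_le`). The degree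
bound makes the union bound for `v` at most `ε / (R * 4 ^ Δ)`. Since at most `R * 2 ^ Δ` coding
nodes have depth `Δ`, and `Δ ≥ 1`, the total is at most the sum of `ε / 2 ^ Δ`, hence at most `ε`.
-/

/-- The nodes that can be reached from the sources by a walk that avoids the set `C`. -/
inductive Reach {ι : Type*} (src : ι → V) (C : Set V) : V → Prop
  | source (i : ι) (h : src i ∉ C) : Reach src C (src i)
  | step (e : E) (h : Reach src C (G.tail e)) (h' : G.head e ∉ C) : Reach src C (G.head e)

open Classical in
/-- The global encoding vectors of the nodes: those of the sources are the unit vectors, and the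
vector of any other node is a combination of the vectors of its in-neighbours. -/
structure IsEncoding {ι K : Type*} [Fintype E] [Field K] (src : ι → V) (c : E → K)
    (y : V → ι → K) : Prop where
  source : ∀ i, y (src i) = Pi.single i 1
  node : ∀ v, v ∉ Set.range src → y v = ∑ e with G.head e = v, c e • y (G.tail e)

section TightCut

variable {ι K : Type*} [Field K] {src : ι → V} {y : V → ι → K}

/-- The rank of the encoding vectors of the nodes of `B` is at least the size of a set of nodes that
separates `B` from the sources. -/
def HasTightCut (src : ι → V) (y : V → ι → K) (B : Set V) : Prop :=
  ∃ C : Finset V, (∀ v ∈ B, ¬ G.Reach src C v) ∧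
    C.card ≤ Module.finrank K (Submodule.span K (y '' B))

variable {G} in
theorem hasTightCut_of_linearIndepOn [Finite ι] {B : Set V} {C : Finset V} (hC : ∀ v ∈ B, ¬ G.Reach src C v)
    (hli : LinearIndepOn K y (C : Set V))
    (hsub : ∀ v ∈ C, y v ∈ Submodule.span K (y '' B)) : G.HasTightCut src y B := by
  refine ⟨C, hC, ?_⟩
  have hli' : LinearIndependent K (fun v : C => (⟨y v, hsub v v.2⟩ : Submodule.span K (y '' B))) :=
    LinearIndependent.of_comp (Submodule.span K (y '' B)).subtype hli
  simpa using hli'.fintype_card_le_finrank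

end TightCut

open Classical in
theorem sum_fiber {M : Type*} [Fintype V] [Fintype E] [AddCommMonoid M] (g : E → V) (f : E → M) :
    ∑ v, ∑ e with g e = v, f e = ∑ e, f e := by
  simp only [Finset.sum_filter]
  rw [Finset.sum_comm]
  simp

/-! ### Linear relations between encoding vectors -/

section Comb

variable {K : Type*} [Field K] [Fintype E]

open Classical in
/-- The combination, with coefficients `a`, of the equations of the nodes. -/
noncomputable def comb (c : E → K) (a : V → K) (v : V) : K :=
  a v - ∑ e with G.tail e = v, c e * a (G.head e)

variable {G}

theorem comb_sub (c : E → K) (a b : V → K) : G.comb c (a - b) = G.comb c a - G.comb c b := by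
  classical
  funext v
  simp only [comb, Pi.sub_apply, mul_sub, Finset.sum_sub_distrib]
  ring

theorem comb_smul (c : E → K) (r : K) (a : V → K) : G.comb c (r • a) = r • G.comb c a := by
  classical
  funext v
  simp only [comb, Pi.smul_apply, smul_eq_mul, mul_sub, Finset.mul_sum]
  congr 1
  exact Finset.sum_congr rfl fun e _ => by ring

variable [Fintype V] {ι : Type*} {src : ι → V} {c : E → K} {y : V → ι → K}

/-- `comb c a` lists the coefficients of the vectors `y v` in the sum of the node equations weighted
by `a`. Sources have no equation, so their weights must vanish. -/
theorem IsEncoding.comb_smul_eq_zero (hy : G.IsEncoding src c y) {a : V → K}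
    (ha : ∀ i, a (src i) = 0) : ∑ v, G.comb c a v • y v = 0 := by
  classical
  have h1 : ∀ v, a v • y v = ∑ e with G.head e = v, (c e * a (G.head e)) • y (G.tail e) := by
    intro v
    by_cases hv : v ∈ Set.range src
    · obtain ⟨i, rfl⟩ := hv
      rw [ha, zero_smul]
      refine (Finset.sum_eq_zero fun e he => ?_).symm
      rw [(Finset.mem_filter.1 he).2, ha, mul_zero, zero_smul]
    · rw [hy.node v hv, Finset.smul_sum]
      refine Finset.sum_congr rfl fun e he => ?_
      rw [(Finset.mem_filter.1 he).2, smul_smul, mul_comm]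
  have h2 : ∀ v, (∑ e with G.tail e = v, c e * a (G.head e)) • y v =
      ∑ e with G.tail e = v, (c e * a (G.head e)) • y (G.tail e) := by
    intro v
    rw [Finset.sum_smul]
    refine Finset.sum_congr rfl fun e he => ?_
    rw [(Finset.mem_filter.1 he).2]
  simp only [comb, sub_smul, Finset.sum_sub_distrib]
  rw [Finset.sum_congr rfl fun v _ => h1 v, Finset.sum_congr rfl fun v _ => h2 v,
    sum_fiber, sum_fiber, sub_self]

/-- The node equations at the nodes of a set can be solved from the top. -/
theorem Acyclic.exists_comb (hG : G.Acyclic) (c : E → K) (T : Set V) (ψ : V → K) :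
    ∃ a : V → K, (∀ v ∉ T, a v = 0) ∧ ∀ v ∈ T, G.comb c a v = ψ v := by
  classical
  obtain ⟨τ, hτ⟩ := hG.exists_rank
  let Φ : (V → K) →ₗ[K] (V → K) :=
    { toFun := fun a v => if v ∈ T then G.comb c a v else a v
      map_add' := fun a b => by
        funext v
        have : G.comb c (a + b) v = G.comb c a v + G.comb c b v := by
          simp only [comb, Pi.add_apply, mul_add, Finset.sum_add_distrib]
          ring
        simp only [Pi.add_apply, this]
        split_ifs <;> rfl
      map_smul' := fun r a => by
        funext v
        simp only [Pi.smul_apply, RingHom.id_apply, comb_smul]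
        split_ifs <;> rfl }
  -- `Φ` is unitriangular for the order `τ`: at the last node where `a` is nonzero, it returns the
  -- value of `a`.
  have hinj : Function.Injective Φ := by
    rw [← LinearMap.ker_eq_bot, LinearMap.ker_eq_bot']
    intro a ha
    by_contra hne
    obtain ⟨w, hw⟩ := Function.ne_iff.1 hne
    obtain ⟨v, hv, hmax⟩ := Finset.exists_max_image (Finset.univ.filter fun v => a v ≠ 0) τ
      ⟨w, by simpa using hw⟩
    have hav : a v ≠ 0 := (Finset.mem_filter.1 hv).2
    have h0 : (if v ∈ T then G.comb c a v else a v) = 0 := congrFun ha v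
    have hcomb : G.comb c a v = a v := by
      rw [comb, Finset.sum_eq_zero, sub_zero]
      intro e he
      have hlt := hτ v (G.head e) ⟨e, (Finset.mem_filter.1 he).2, rfl⟩
      by_contra hne'
      exact absurd (hmax (G.head e) (by simpa using right_ne_zero_of_mul hne')) (by omega)
    rw [hcomb, ite_self] at h0
    exact hav h0
  obtain ⟨a, ha⟩ := (LinearMap.injective_iff_surjective.1 hinj) fun v => if v ∈ T then ψ v else 0
  have ha' : ∀ v, (if v ∈ T then G.comb c a v else a v) = if v ∈ T then ψ v else 0 :=
    fun v => congrFun ha v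
  refine ⟨a, fun v hv => by simpa [hv] using ha' v, fun v hv => by simpa [hv] using ha' v⟩

/-- At the topologically last node where `a` is nonzero, no later term interferes, so the
combination keeps that entry. -/
theorem Acyclic.comb_injective (hG : G.Acyclic) {a : V → K} {A : Set V}
    (ha : ∀ v ∉ A, a v = 0) (h : ∀ v ∈ A, G.comb c a v = 0) : a = 0 := by
  classical
  obtain ⟨τ, hτ⟩ := hG.exists_rank
  by_contra hne
  obtain ⟨w, hw⟩ := Function.ne_iff.1 hne
  obtain ⟨v, hv, hmax⟩ := Finset.exists_max_image (Finset.univ.filter fun v => a v ≠ 0) τ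
    ⟨w, by simpa using hw⟩
  have hav : a v ≠ 0 := (Finset.mem_filter.1 hv).2
  have hcomb : G.comb c a v = a v := by
    rw [comb, Finset.sum_eq_zero, sub_zero]
    intro e he
    have hlt := hτ v (G.head e) ⟨e, (Finset.mem_filter.1 he).2, rfl⟩
    by_contra hne'
    exact absurd (hmax (G.head e) (by simpa using right_ne_zero_of_mul hne')) (by omega)
  exact hav (hcomb ▸ h v (by_contra fun hvA => hav (ha v hvA)))

/-- A linear relation between the encoding vectors of nodes that are separated from the sources by
independent nodes `C` is a combination of the equations of the nodes behind `C`. -/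
theorem IsEncoding.exists_comb_eq (hG : G.Acyclic) (hy : G.IsEncoding src c y)
    {C D : Set V} (hC : LinearIndepOn K y C) (hsrc : ∀ i, src i ∈ D → src i ∈ C)
    (hD : ∀ e, G.head e ∈ D → G.head e ∉ C → G.tail e ∈ D) {ψ : V → K}
    (hψD : ∀ v ∉ D, ψ v = 0) (hψ : ∑ v, ψ v • y v = 0) :
    ∃ a : V → K, (∀ v, a v ≠ 0 → v ∈ D ∧ v ∉ C) ∧ G.comb c a = ψ := by
  classical
  obtain ⟨a, ha, haψ⟩ := hG.exists_comb c (D \ C) ψ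
  refine ⟨a, fun v hv => by_contra fun h => hv (ha v h), ?_⟩
  have hsup : ∀ v ∉ C, (ψ - G.comb c a) v = 0 := by
    intro v hvC
    by_cases hvD : v ∈ D
    · rw [Pi.sub_apply, haψ v ⟨hvD, hvC⟩, sub_self]
    · rw [Pi.sub_apply, hψD v hvD, comb, ha v fun h => hvD h.1, Finset.sum_eq_zero]
      · simp
      · intro e he
        rw [ha _ fun h => hvD ?_, mul_zero]
        rw [← (Finset.mem_filter.1 he).2]
        exact hD e h.1 h.2
  -- What remains of `ψ` lives on `C` and is still a relation, so independence of `C` kills it.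
  have hrel : ∑ v, (ψ - G.comb c a) v • y v = 0 := by
    simp only [Pi.sub_apply, sub_smul, Finset.sum_sub_distrib, hψ]
    rw [hy.comb_smul_eq_zero fun i => ha _ fun h => h.2 (hsrc i h.1), sub_zero]
  have hC' := (linearIndepOn_iff'.1 hC) (Finset.univ.filter (· ∈ C)) (ψ - G.comb c a)
    (by simp) (by
      refine (Finset.sum_filter _ _).trans (Eq.trans ?_ hrel)
      refine Finset.sum_congr rfl fun v _ => ?_
      split_ifs with h
      · rfl
      · rw [hsup v h, zero_smul])
  funext v
  by_cases hv : v ∈ C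
  · exact (sub_eq_zero.1 (hC' v (by simpa using hv))).symm
  · exact (sub_eq_zero.1 (hsup v hv)).symm

theorem IsEncoding.linearIndepOn_range (hy : G.IsEncoding src c y) :
    LinearIndepOn K y (Set.range src) := by
  classical
  by_cases hι : Nonempty ι
  · have hinj : Function.Injective src := by
      intro i j hij
      have := (hy.source i).symm.trans (hij ▸ hy.source j)
      by_contra hne
      have := congrFun this i
      simp [hne] at this
    rw [LinearIndepOn.eq_1]
    have : (fun x : Set.range src => y x) ∘ (Equiv.ofInjective src hinj) =
        fun i => Pi.single i (1 : K) := by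
      funext i
      simp [hy.source]
    rw [← linearIndependent_equiv (Equiv.ofInjective src hinj), this]
    have hfin : Finite ι := Finite.of_injective src hinj
    simpa using Pi.linearIndependent_single_one ι K
  · rw [not_nonempty_iff] at hι
    rw [Set.range_eq_empty]
    exact linearIndepOn_empty K y

/-- An unreached node outside `C` is not a source, and all its in-neighbours are unreached; induct
along the graph. -/
theorem IsEncoding.mem_span_of_not_reach (hG : G.Acyclic) (hy : G.IsEncoding src c y) {C : Set V}
    {v : V} (hv : ¬ G.Reach src C v) : y v ∈ Submodule.span K (y '' C) := by
  classical
  obtain ⟨τ, hτ⟩ := hG.exists_rank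
  induction hn : τ v using Nat.strong_induction_on generalizing v with
  | _ n ih =>
    by_cases hvC : v ∈ C
    · exact Submodule.subset_span ⟨v, hvC, rfl⟩
    · rw [hy.node v (by rintro ⟨i, rfl⟩; exact hv (.source i hvC))]
      refine Submodule.sum_mem _ fun e he => Submodule.smul_mem _ _ ?_
      obtain rfl := (Finset.mem_filter.1 he).2
      exact ih _ (hn ▸ hτ _ _ ⟨e, rfl, rfl⟩) (fun h => hv (.step e h hvC)) rfl

/-- If a node has generic coefficients, then its equation does not contribute to the relations
between the vectors in a subspace that does not contain all its in-neighbours. -/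
theorem IsEncoding.coeff_eq_zero_of_generic (hy : G.IsEncoding src c y)
    {H : Submodule K (ι → K)} {e₀ : E} {σ : K →+* K}
    (hσ₀ : σ (c e₀) = c e₀ + 1) (hσ : ∀ e ≠ e₀, σ (c e) = c e) (he₀ : y (G.tail e₀) ∉ H)
    {a : V → K} (ha : ∀ i, a (src i) = 0) (haH : ∀ v, y v ∉ H → G.comb c a v = 0) :
    a (G.head e₀) = 0 := by
  classical
  by_contra hne
  set u := G.head e₀ with hu
  -- With the weight at `u` equal to 1, applying `σ` to `comb c b` changes the coefficient at
  -- `G.tail e₀` by exactly 1. Hence `d`, the difference of `σ ∘ b` and `b`, yields a relation whose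
  -- only term outside `H` is `y (G.tail e₀)`, forcing that vector into `H`.
  set b : V → K := (a u)⁻¹ • a with hb
  have hbu : b u = 1 := by simp [hb, hne]
  have hbH : ∀ v, y v ∉ H → G.comb c b v = 0 := fun v hv => by
    rw [hb, comb_smul, Pi.smul_apply, haH v hv, smul_zero]
  have hbs : ∀ i, b (src i) = 0 := fun i => by simp [hb, ha]
  have hshift : ∀ v, σ (G.comb c b v) =
      G.comb c (fun w => σ (b w)) v - if G.tail e₀ = v then 1 else 0 := by
    intro v
    rw [comb, comb, map_sub, map_sum, sub_sub]
    congr 1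
    have hone : (if G.tail e₀ = v then (1 : K) else 0) =
        ∑ e, if e = e₀ then (if G.tail e = v then (1 : K) else 0) else 0 := by simp
    rw [Finset.sum_filter, Finset.sum_filter, hone, ← Finset.sum_add_distrib]
    refine Finset.sum_congr rfl fun e _ => ?_
    rw [map_mul]
    by_cases he : e = e₀
    · subst he
      rw [hσ₀, ← hu, hbu, map_one]
      simp only [if_true]
      split_ifs <;> ring
    · rw [hσ e he, if_neg he]
      split_ifs <;> ring
  set d : V → K := fun w => σ (b w) - b w with hd
  have hds : ∀ i, d (src i) = 0 := fun i => by simp [hd, hbs]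
  have hdH : ∀ v, y v ∉ H → G.comb c d v = if G.tail e₀ = v then 1 else 0 := by
    intro v hv
    have h1 := hshift v
    rw [hbH v hv, map_zero] at h1
    have h2 : G.comb c d v = G.comb c (fun w => σ (b w)) v - G.comb c b v :=
      congrFun (comb_sub c (fun w => σ (b w)) b) v
    rw [h2, hbH v hv, sub_zero]
    exact (sub_eq_zero.1 h1.symm)
  have hzero := hy.comb_smul_eq_zero hds
  rw [← Finset.add_sum_erase _ _ (Finset.mem_univ (G.tail e₀)), hdH _ he₀, if_pos rfl, one_smul]
    at hzero
  refine he₀ (eq_neg_of_add_eq_zero_left hzero ▸ H.neg_mem (H.sum_mem fun v hv => ?_))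
  by_cases hvH : y v ∈ H
  · exact H.smul_mem _ hvH
  · rw [hdH v hvH, if_neg (Finset.ne_of_mem_erase hv).symm, zero_smul]
    exact H.zero_mem

/-- If the coefficients of the nodes in `U` are generic, those of the nodes in `P` are arbitrary and
the other nodes forward the packet that they receive, then every set of nodes has a tight cut if all
subsets of `P` and its in-neighbours have one. -/
theorem IsEncoding.hasTightCut [Finite ι] (hG : G.Acyclic) (hy : G.IsEncoding src c y)
    {P U : Set V}
    (hU : ∀ e₀, G.head e₀ ∈ U → ∃ σ : K →+* K, σ (c e₀) = c e₀ + 1 ∧ ∀ e ≠ e₀, σ (c e) = c e)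
    (hcopy : ∀ e, G.head e ∉ P → G.head e ∉ U →
      c e ≠ 0 ∧ ∀ e', G.head e' = G.head e → e' = e)
    (hsrc : ∀ e i, G.head e ≠ src i)
    (hP : ∀ B ⊆ P ∪ {v | ∃ e, G.tail e = v ∧ G.head e ∈ P}, G.HasTightCut src y B) (B : Set V) :
    G.HasTightCut src y B := by
  classical
  set H := Submodule.span K (y '' B) with hH
  set A : Set V := {v | y v ∈ H} with hA
  obtain ⟨C, hCB, hCcard⟩ := hP (A ∩ (P ∪ {v | ∃ e, G.tail e = v ∧ G.head e ∈ P}))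
    Set.inter_subset_right
  set B' := A ∩ (P ∪ {v | ∃ e, G.tail e = v ∧ G.head e ∈ P}) with hB'
  set D : Set V := {v | ¬ G.Reach src C v} with hD
  have hle : Submodule.span K (y '' B') ≤ Submodule.span K (y '' (C : Set V)) := by
    rw [Submodule.span_le]
    rintro _ ⟨v, hv, rfl⟩
    exact hy.mem_span_of_not_reach hG (hCB v hv)
  have hspanC : Module.finrank K (Submodule.span K (y '' (C : Set V))) ≤ C.card := by
    rw [← Finset.coe_image]
    exact (finrank_span_finset_le_card _).trans Finset.card_image_le
  have hfin : Module.Finite K (Submodule.span K (y '' (C : Set V))) := inferInstance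
  -- The span of `C` contains that of `B'`, and `C` has no more elements than the rank of `B'`: the
  -- vectors of `C` form a basis of the common span.
  have heq : Submodule.span K (y '' B') = Submodule.span K (y '' (C : Set V)) :=
    Submodule.eq_of_le_of_finrank_le hle (hspanC.trans hCcard)
  have hCli : LinearIndepOn K y (C : Set V) := by
    rw [LinearIndepOn.eq_1, linearIndependent_iff_card_le_finrank_span]
    have : Set.range (fun x : (C : Set V) => y x) = y '' (C : Set V) := by
      rw [Set.image_eq_range]
    rw [Set.finrank, this, ← heq]
    simpa using hCcard
  have hDA : D ⊆ A := fun v hv => by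
    have h1 := hy.mem_span_of_not_reach hG hv
    rw [← heq] at h1
    refine (Submodule.span_le (p := H)).2 ?_ h1
    rintro _ ⟨w, hw, rfl⟩
    exact hw.1
  have hDtail : ∀ e, G.head e ∈ D → G.head e ∉ (C : Set V) → G.tail e ∈ D :=
    fun e he heC h => he (.step e h heC)
  have hDsrc : ∀ i, src i ∈ D → src i ∈ (C : Set V) := fun i hi =>
    by_contra fun h => hi (.source i h)
  have hclosed : ∀ v, v ∉ Set.range src → (∀ e, G.head e = v → G.tail e ∈ A) → v ∈ A := by
    intro v hv h
    rw [hA, Set.mem_ofPred_eq, hy.node v hv]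
    exact H.sum_mem fun e he => H.smul_mem _ (h e (Finset.mem_filter.1 he).2)
  have hcopyA : ∀ e, G.head e ∉ P → G.head e ∉ U → G.head e ∈ A → G.tail e ∈ A := by
    intro e heP heU heA
    obtain ⟨hne, huniq⟩ := hcopy e heP heU
    have h1 : y (G.head e) = c e • y (G.tail e) := by
      rw [hy.node _ (by rintro ⟨i, hi⟩; exact hsrc e i hi.symm)]
      refine Finset.sum_eq_single_of_mem e (by simp) fun e' he' hne' => ?_
      exact absurd (huniq e' (Finset.mem_filter.1 he').2) hne'
    rw [hA, Set.mem_ofPred_eq, h1] at heA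
    exact (H.smul_mem_iff hne).1 heA
  -- the nodes whose equations generate all relations between the nodes of `A`
  set N : Set V := {v | v ∉ Set.range src ∧ v ∉ P ∧ ∀ e, G.head e = v → G.tail e ∈ A} with hN
  have hNA : ∀ v ∈ N, v ∈ A := fun v hv => hclosed v hv.1 hv.2.2
  -- Every relation inside `A` uses only equations from `N` and from behind `C`. Remove the part of
  -- `a` on `N`. By genericity the rest `b` lives on `P` and on forwarding nodes with an
  -- in-neighbour outside `A`.
  have key : ∀ a : V → K, (∀ i, a (src i) = 0) → (∀ v ∉ A, G.comb c a v = 0) →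
      ∀ v, a v ≠ 0 → v ∈ N ∪ (D \ C) := by
    intro a has haA
    set b : V → K := fun v => if v ∈ N then 0 else a v with hb
    have hbs : ∀ i, b (src i) = 0 := fun i => by simp [hb, has]
    have hbP : ∀ v, b v ≠ 0 → v ∈ P ∨ ∃ e, G.head e = v ∧ G.tail e ∉ A ∧ v ∉ P ∧ v ∉ U := by
      intro v hbv
      by_contra! hcon
      have hvN : v ∉ N := fun h => hbv (if_pos h)
      have hav : a v ≠ 0 := by simpa [hb, hvN] using hbv
      have hvs : v ∉ Set.range src := by rintro ⟨i, rfl⟩; exact hav (has i)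
      have : ∃ e, G.head e = v ∧ G.tail e ∉ A := by
        by_contra! hall
        exact hvN ⟨hvs, hcon.1, hall⟩
      obtain ⟨e, rfl, heA⟩ := this
      have hvU := hcon.2 e rfl heA hcon.1
      obtain ⟨σ, hσ₀, hσ⟩ := hU e hvU
      exact hav (hy.coeff_eq_zero_of_generic (H := H) hσ₀ hσ (fun h => heA h) has fun v hv => haA v hv)
    have hbA : ∀ v, G.comb c b v ≠ 0 → v ∈ A := by
      intro v hv
      by_contra hvA
      refine hv ?_
      rw [← haA v hvA, comb, comb]
      congr 1
      · exact if_neg fun h => hvA (hNA v h)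
      · refine Finset.sum_congr rfl fun e he => ?_
        obtain rfl := (Finset.mem_filter.1 he).2
        rw [hb]
        simp only
        rw [if_neg fun h : G.head e ∈ N => hvA (h.2.2 e rfl)]
    -- A forwarding node lies in `A` exactly when its only in-neighbour does, so the forwarding
    -- nodes in the support of `b` involve no node of `A`. The relation given by `b` thus lives on
    -- `B'`, which is contained in `D`.
    have hbD : ∀ v ∉ D, G.comb c b v = 0 := by
      intro v hvD
      by_contra hne
      have hvA := hbA v hne
      refine hvD (hCB v ⟨hvA, ?_⟩)
      by_contra hvP
      rw [Set.mem_union, not_or] at hvP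
      refine hne ?_
      rw [comb, Finset.sum_eq_zero, sub_zero]
      · by_contra hbv
        obtain h | ⟨e, rfl, heA, heP, heU⟩ := hbP v hbv
        · exact hvP.1 h
        · exact heA (hcopyA e heP heU hvA)
      · intro e he
        obtain rfl := (Finset.mem_filter.1 he).2
        by_contra hbe
        obtain h | ⟨e', he', heA', heP, heU⟩ := hbP _ (right_ne_zero_of_mul hbe)
        · exact hvP.2 ⟨e, rfl, h⟩
        · rw [(hcopy e heP heU).2 e' he'] at heA'
          exact heA' hvA
    obtain ⟨a', ha', ha'b⟩ := hy.exists_comb_eq hG hCli hDsrc hDtail hbD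
      (hy.comb_smul_eq_zero hbs)
    have hba' : b - a' = 0 := by
      refine hG.comb_injective (c := c) (A := Set.univ) (by simp) fun v _ => ?_
      rw [comb_sub, ha'b, sub_self, Pi.zero_apply]
    intro v hav
    by_cases hvN : v ∈ N
    · exact .inl hvN
    · refine .inr (ha' v ?_)
      rw [← sub_eq_zero.1 hba']
      simpa [hb, hvN] using hav
  have hinA : ∀ v ∈ N ∪ (D \ C), v ∈ A ∧ v ∉ Set.range src ∧
      ∀ e, G.head e = v → G.tail e ∈ A := by
    rintro v (hv | hv)
    · exact ⟨hNA v hv, hv.1, hv.2.2⟩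
    · refine ⟨hDA hv.1, ?_, ?_⟩
      · rintro ⟨i, rfl⟩
        exact hv.2 (hDsrc i hv.1)
      · rintro e rfl
        exact hDA (hDtail e hv.1 hv.2)
  have hBA : ∀ v ∈ B, v ∈ A := fun v hv => Submodule.subset_span ⟨v, hv, rfl⟩
  -- The cut is the rest of `A`. It separates, since every removed node is a non-source with all
  -- in-neighbours in `A`. It is independent, since a relation on it comes from equations at removed
  -- nodes, where the relation itself vanishes.
  refine hasTightCut_of_linearIndepOn (C := Finset.univ.filter fun v => v ∈ A \ (N ∪ (D \ C)))
    ?_ ?_ ?_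
  · intro v hv hreach
    have : ∀ w, G.Reach src
        (Finset.univ.filter fun v => v ∈ A \ (N ∪ (D \ C)) : Finset V) w → w ∉ A := by
      intro w hw
      induction hw with
      | source i h =>
        intro hiA
        refine h ?_
        simp only [Finset.coe_filter, Finset.mem_univ, true_and, Set.mem_ofPred_eq]
        exact ⟨hiA, fun h' => (hinA _ h').2.1 ⟨i, rfl⟩⟩
      | step e _ h ih =>
        intro heA
        refine h ?_
        simp only [Finset.coe_filter, Finset.mem_univ, true_and, Set.mem_ofPred_eq]
        exact ⟨heA, fun h' => ih ((hinA _ h').2.2 e rfl)⟩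
    exact this v hreach (hBA v hv)
  · rw [linearIndepOn_finset_iff]
    intro ψ hψ v hv
    set ψ' : V → K := fun v => if v ∈ A \ (N ∪ (D \ C)) then ψ v else 0 with hψ'
    have hrel : ∑ v, ψ' v • y v = 0 := by
      rw [← hψ, Finset.sum_filter]
      refine Finset.sum_congr rfl fun w _ => ?_
      simp only [hψ']
      split_ifs <;> simp
    -- Cutting at the sources themselves shows that every relation is a combination of node
    -- equations.
    obtain ⟨a, ha, haψ⟩ := hy.exists_comb_eq hG (C := Set.range src) (D := Set.univ)
      hy.linearIndepOn_range (fun i _ => ⟨i, rfl⟩) (by simp) (ψ := ψ') (by simp) hrel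
    have has : ∀ i, a (src i) = 0 := fun i => by_contra fun h => (ha _ h).2 ⟨i, rfl⟩
    have haN := key a has fun v hv => by rw [haψ]; exact if_neg fun h => hv h.1
    have ha0 : a = 0 := hG.comb_injective (c := c) (A := N ∪ (D \ C))
      (fun v hv => by_contra fun h => hv (haN v h))
      fun v hv => by rw [haψ]; exact if_neg fun h => h.2 hv
    have hv0 : ψ' v = 0 := by
      rw [← haψ, ha0]
      simp [comb]
    rw [hψ'] at hv0
    simpa [(Finset.mem_filter.1 hv).2] using hv0
  · intro v hv
    exact (Finset.mem_filter.1 hv).2.1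

end Comb

end MultiDigraph

/-! ### Generic coefficients -/

section Generic

variable (E F : Type*) [Field F]

/-- The field of rational functions in variables indexed by `E`. -/
abbrev GenericField : Type _ := FractionRing (MvPolynomial E F)

variable {E}

/-- The generic coefficient of `e`. -/
noncomputable def genericVar (e : E) : GenericField E F :=
  algebraMap (MvPolynomial E F) (GenericField E F) (MvPolynomial.X e)

-- Substituting `X e₀ + 1` for `X e₀` is invertible on polynomials, so it extends to the fraction
-- field. This is the only form in which genericity is used.
open Classical in
theorem exists_shift (e₀ : E) : ∃ σ : GenericField E F →+* GenericField E F,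
    σ (genericVar F e₀) = genericVar F e₀ + 1 ∧
    (∀ e ≠ e₀, σ (genericVar F e) = genericVar F e) ∧
    ∀ r : F, σ (algebraMap F _ r) = algebraMap F _ r := by
  let f : F → MvPolynomial E F →ₐ[F] MvPolynomial E F := fun r =>
    MvPolynomial.aeval fun e => if e = e₀ then MvPolynomial.X e + MvPolynomial.C r
      else MvPolynomial.X e
  have hf : ∀ e, f 1 (MvPolynomial.X e) = if e = e₀ then MvPolynomial.X e + 1
      else MvPolynomial.X e := fun e => by simp [f]
  have hinv : (f (-1)).comp (f 1) = AlgHom.id F _ := by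
    refine MvPolynomial.algHom_ext fun e => ?_
    rw [AlgHom.comp_apply, hf]
    split_ifs with he <;> simp [f, he]
  have hinj : Function.Injective (f 1) := by
    intro p q hpq
    have h : ∀ p, f (-1) (f 1 p) = p := fun p => by rw [← AlgHom.comp_apply, hinv]; rfl
    rw [← h p, hpq, h]
  have hg : Function.Injective
      ((algebraMap (MvPolynomial E F) (GenericField E F)).comp (f 1).toRingHom) :=
    (IsFractionRing.injective _ _).comp hinj
  refine ⟨IsFractionRing.lift hg, ?_, fun e he => ?_, fun r => ?_⟩
  · rw [genericVar, IsFractionRing.lift_algebraMap]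
    simp [hf]
  · rw [genericVar, IsFractionRing.lift_algebraMap]
    simp [hf, he]
  · rw [IsScalarTower.algebraMap_apply F (MvPolynomial E F), IsFractionRing.lift_algebraMap]
    simp

end Generic

/-! ### Determinants that detect independence of encoding vectors -/

namespace MultiDigraph

variable {V E ι K : Type*} {G : MultiDigraph V E} [Field K] [Fintype E]
  {src : ι → V} {c : E → K}

variable (G)

open Classical in
/-- The matrix of the equations that say that a solution of the equations of the nodes vanishes at
the nodes `s i`. -/
noncomputable def equationMatrix (src : ι → V) (c : E → K) (s : ι → V) : Matrix V V K :=
  Matrix.of fun v => if h : ∃ i, src i = v then Pi.single (s h.choose) 1 else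
    Pi.single v 1 - ∑ e with G.head e = v, c e • Pi.single (G.tail e) 1

variable {G}

-- The coefficients on edges into `v` occur only in row `v`, which is overwritten.
open Classical in
theorem equationMatrix_updateRow_congr {c' : E → K} {v : V}
    (h : ∀ e, G.head e ≠ v → c e = c' e) (s : ι → V) (x : V → K) :
    (G.equationMatrix src c s).updateRow v x = (G.equationMatrix src c' s).updateRow v x := by
  ext w j
  by_cases hw : w = v
  · subst hw; simp
  · rw [Matrix.updateRow_ne hw, Matrix.updateRow_ne hw]
    simp only [equationMatrix, Matrix.of_apply]
    refine congrFun ?_ j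
    split_ifs
    · rfl
    · congr 1
      refine Finset.sum_congr rfl fun e he => ?_
      rw [h e ((Finset.mem_filter.1 he).2 ▸ hw)]

variable [Fintype V]

theorem Acyclic.exists_isEncoding [Fintype ι] (hG : G.Acyclic) (hinj : Function.Injective src)
    (c : E → K) : ∃ y, G.IsEncoding src c y := by
  classical
  obtain ⟨τ, hτ⟩ := hG.exists_rank
  let Φ : (V → ι → K) →ₗ[K] (V → ι → K) :=
    { toFun := fun y v => if v ∈ Set.range src then y v else
        y v - ∑ e with G.head e = v, c e • y (G.tail e)
      map_add' := fun y z => by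
        funext v
        simp only [Pi.add_apply, smul_add, Finset.sum_add_distrib]
        split_ifs
        · rfl
        · abel
      map_smul' := fun r y => by
        funext v
        simp only [Pi.smul_apply, RingHom.id_apply]
        split_ifs
        · rfl
        · rw [smul_sub, Finset.smul_sum]
          congr 1
          exact Finset.sum_congr rfl fun e _ => smul_comm _ _ _ }
  have hΦ : Function.Injective Φ := by
    rw [← LinearMap.ker_eq_bot, LinearMap.ker_eq_bot']
    intro y hy
    have hy' : ∀ v, (if v ∈ Set.range src then y v else
        y v - ∑ e with G.head e = v, c e • y (G.tail e)) = 0 := fun v => congrFun hy v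
    have : ∀ n v, τ v = n → y v = 0 := by
      intro n
      induction n using Nat.strong_induction_on with
      | _ n ih =>
        intro v hv
        have h := hy' v
        split_ifs at h with hs
        · exact h
        · rw [sub_eq_zero] at h
          rw [h]
          refine Finset.sum_eq_zero fun e he => ?_
          obtain rfl := (Finset.mem_filter.1 he).2
          rw [ih _ (hv ▸ hτ _ _ ⟨e, rfl, rfl⟩) _ rfl, smul_zero]
    funext v
    exact this _ v rfl
  obtain ⟨y, hy⟩ := (LinearMap.injective_iff_surjective.1 hΦ)
    fun v i => if src i = v then 1 else 0
  have hy' : ∀ v, (if v ∈ Set.range src then y v else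
      y v - ∑ e with G.head e = v, c e • y (G.tail e)) = fun i => if src i = v then 1 else 0 :=
    fun v => congrFun hy v
  refine ⟨y, fun i => ?_, fun v hv => ?_⟩
  · have h := hy' (src i)
    rw [if_pos ⟨i, rfl⟩] at h
    rw [h]
    funext j
    by_cases hij : j = i
    · simp [hij]
    · simp [hij, hinj.eq_iff]
  · have h := hy' v
    rw [if_neg hv, sub_eq_iff_eq_add] at h
    rw [h, add_eq_right]
    funext i
    exact if_neg fun h => hv ⟨i, h⟩

/-- A coefficient that multiplies a zero vector has no effect. This lets unreachable coding nodes
keep generic coefficients. -/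
theorem IsEncoding.ext_of_eq (hG : G.Acyclic) {c' : E → K} {y y' : V → ι → K}
    (hy : G.IsEncoding src c y) (hy' : G.IsEncoding src c' y')
    (h : ∀ e, y (G.tail e) ≠ 0 → c e = c' e) : y = y' := by
  classical
  obtain ⟨τ, hτ⟩ := hG.exists_rank
  have : ∀ n v, τ v = n → y v = y' v := by
    intro n
    induction n using Nat.strong_induction_on with
    | _ n ih =>
      intro v hv
      by_cases hs : v ∈ Set.range src
      · obtain ⟨i, rfl⟩ := hs
        rw [hy.source, hy'.source]
      · rw [hy.node v hs, hy'.node v hs]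
        refine Finset.sum_congr rfl fun e he => ?_
        obtain rfl := (Finset.mem_filter.1 he).2
        rw [← ih _ (hv ▸ hτ _ _ ⟨e, rfl, rfl⟩) _ rfl]
        by_cases h0 : y (G.tail e) = 0
        · rw [h0, smul_zero, smul_zero]
        · rw [h e h0]
  funext v
  exact this _ v rfl

-- A kernel vector `h` solves the node equations, hence is `y v ⬝ᵥ φ` with `φ` its values at the
-- sources. The remaining rows say that `φ` is orthogonal to every `y (s i)`.
open Classical in
theorem IsEncoding.det_equationMatrix_eq_zero_iff [Fintype ι] (hG : G.Acyclic)
    (hinj : Function.Injective src) {y : V → ι → K} (hy : G.IsEncoding src c y) (s : ι → V) :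
    (G.equationMatrix src c s).det = 0 ↔ ¬ LinearIndependent K fun i => y (s i) := by
  have hrow : ∀ (h : V → K) i, (G.equationMatrix src c s).mulVec h (src i) = h (s i) := by
    intro h i
    have hex : ∃ j, src j = src i := ⟨i, rfl⟩
    simp only [Matrix.mulVec, equationMatrix, Matrix.of_apply, dif_pos hex]
    rw [hinj hex.choose_spec, single_dotProduct, one_mul]
  have hrow' : ∀ (h : V → K) v, v ∉ Set.range src →
      (G.equationMatrix src c s).mulVec h v =
        h v - ∑ e with G.head e = v, c e * h (G.tail e) := by
    intro h v hv
    have hv' : ¬ ∃ i, src i = v := hv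
    simp only [Matrix.mulVec, equationMatrix, Matrix.of_apply, dif_neg hv']
    rw [sub_dotProduct, sum_dotProduct, single_dotProduct, one_mul]
    simp only [smul_dotProduct, single_dotProduct, one_mul, smul_eq_mul]
  have hY : (¬ LinearIndependent K fun i => y (s i)) ↔
      ∃ φ : ι → K, φ ≠ 0 ∧ (Matrix.of fun i => y (s i)).mulVec φ = 0 := by
    rw [Matrix.exists_mulVec_eq_zero_iff, ← not_iff_not, not_not, ← Ne.eq_def, ← isUnit_iff_ne_zero,
      ← Matrix.isUnit_iff_isUnit_det, ← Matrix.linearIndependent_rows_iff_isUnit]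
    rfl
  rw [hY, ← Matrix.exists_mulVec_eq_zero_iff]
  constructor
  · rintro ⟨h, hne, hh⟩
    have hval : ∀ v, h v = y v ⬝ᵥ fun i => h (src i) := by
      obtain ⟨τ, hτ⟩ := hG.exists_rank
      have : ∀ n v, τ v = n → h v = y v ⬝ᵥ fun i => h (src i) := by
        intro n
        induction n using Nat.strong_induction_on with
        | _ n ih =>
          intro v hv
          by_cases hs : v ∈ Set.range src
          · obtain ⟨i, rfl⟩ := hs
            rw [hy.source, single_dotProduct, one_mul]
          · have h1 := hrow' h v hs
            rw [hh, Pi.zero_apply, eq_comm, sub_eq_zero] at h1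
            rw [h1, hy.node v hs, sum_dotProduct]
            refine Finset.sum_congr rfl fun e he => ?_
            obtain rfl := (Finset.mem_filter.1 he).2
            rw [smul_dotProduct, smul_eq_mul, ← ih _ (hv ▸ hτ _ _ ⟨e, rfl, rfl⟩) _ rfl]
      exact fun v => this _ v rfl
    refine ⟨fun i => h (src i), fun h0 => hne ?_, ?_⟩
    · funext v
      rw [hval, h0, dotProduct_zero, Pi.zero_apply]
    · funext i
      have := hrow h i
      rw [hh, Pi.zero_apply, hval] at this
      exact this.symm
  · rintro ⟨φ, hne, hφ⟩
    refine ⟨fun v => y v ⬝ᵥ φ, fun h0 => hne ?_, ?_⟩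
    · funext i
      have := congrFun h0 (src i)
      simpa [hy.source, single_dotProduct] using this
    · funext v
      by_cases hs : v ∈ Set.range src
      · obtain ⟨i, rfl⟩ := hs
        rw [hrow]
        exact congrFun hφ i
      · rw [hrow' _ _ hs, hy.node v hs, sum_dotProduct, Pi.zero_apply, sub_eq_zero]
        exact Finset.sum_congr rfl fun e _ => by rw [smul_dotProduct, smul_eq_mul]

open Classical in
/-- The determinant of the equations is affine in the coefficients of one node. -/
theorem det_equationMatrix (c : E → K) {v : V} (hv : v ∉ Set.range src) (s : ι → V) :
    (G.equationMatrix src c s).det =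
      ((G.equationMatrix src c s).updateRow v (Pi.single v 1)).det -
      ∑ e with G.head e = v,
        c e * ((G.equationMatrix src c s).updateRow v (Pi.single (G.tail e) 1)).det := by
  set M := G.equationMatrix src c s with hM
  let Λ : (V → K) →ₗ[K] K :=
    { toFun := fun x => (M.updateRow v x).det
      map_add' := fun x z => Matrix.det_updateRow_add _ _ _ _
      map_smul' := fun r x => Matrix.det_updateRow_smul _ _ _ _ }
  have hrow : M v = Pi.single v 1 - ∑ e with G.head e = v, c e • Pi.single (G.tail e) 1 := by
    rw [hM]
    simp only [equationMatrix]
    exact dif_neg hv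
  have h : M.det = Λ (M v) := by
    change _ = (M.updateRow v (M v)).det
    rw [Matrix.updateRow_eq_self]
  rw [h, hrow, map_sub, map_sum]
  congr 1
  exact Finset.sum_congr rfl fun e _ => by rw [map_smul, smul_eq_mul]; rfl

end MultiDigraph

/-! ### Counting solutions of a random linear equation -/

open Classical in
/-- A linear equation with a nonzero coefficient holds with probability at most `1 / q` if each
unknown is drawn uniformly from a set with `q` elements. -/
theorem card_linear_equation_mul_le {I L : Type*} [Fintype I] {B : I → Type*} [∀ i, Finite (B i)]
    [Field L] (val : ∀ i, B i → L) (hval : ∀ i, Function.Injective (val i)) (T : Finset I) (q : ℕ)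
    (hq : ∀ i ∈ T, Nat.card (B i) = q) (α : (∀ i, B i) → L) (γ : (∀ i, B i) → I → L)
    (hα : ∀ ω ω', (∀ i ∉ T, ω i = ω' i) → α ω = α ω')
    (hγ : ∀ ω ω', (∀ i ∉ T, ω i = ω' i) → γ ω = γ ω') :
    {ω : ∀ i, B i | (∃ i ∈ T, γ ω i ≠ 0) ∧ α ω = ∑ i ∈ T, γ ω i * val i (ω i)}.ncard * q ≤
      Nat.card (∀ i, B i) := by
  set Ev := {ω : ∀ i, B i | (∃ i ∈ T, γ ω i ≠ 0) ∧ α ω = ∑ i ∈ T, γ ω i * val i (ω i)} with hEv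
  have hex : ∀ ω : Ev, ∃ i ∈ T, γ ω i ≠ 0 := fun ω => ω.2.1
  -- The index is chosen from `γ ω` alone, which ignores the coordinates in `T`. It can therefore be
  -- recovered after one of them is overwritten, and the equation then restores the lost value.
  let g : (I → L) → Option I := fun δ => if h : ∃ i ∈ T, δ i ≠ 0 then some h.choose else none
  have hg : ∀ ω : Ev, ∃ i ∈ T, γ ω i ≠ 0 ∧ g (γ ω) = some i := fun ω =>
    ⟨(hex ω).choose, (hex ω).choose_spec.1, (hex ω).choose_spec.2, dif_pos (hex ω)⟩
  choose i₀ hi₀T hi₀ hi₀g using hg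
  let eqv : ∀ i : T, Fin q ≃ B i := fun i => (Finite.equivFinOfCardEq (hq i i.2)).symm
  let f : Ev × Fin q → ∀ i, B i := fun p =>
    Function.update p.1.1 (i₀ p.1) (eqv ⟨i₀ p.1, hi₀T p.1⟩ p.2)
  have hf : Function.Injective f := by
    rintro ⟨ω, k⟩ ⟨ω', k'⟩ h
    have hoff : ∀ i ∉ T, ω.1 i = ω'.1 i := by
      intro i hi
      have h1 := congrFun h i
      have hne : i ≠ i₀ ω := fun h => hi (h ▸ hi₀T ω)
      have hne' : i ≠ i₀ ω' := fun h => hi (h ▸ hi₀T ω')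
      simpa [f, Function.update_of_ne hne, Function.update_of_ne hne'] using h1
    have hγ' := hγ _ _ hoff
    have hi : i₀ ω = i₀ ω' := by
      have := (hi₀g ω).symm.trans ((congrArg g hγ').trans (hi₀g ω'))
      exact Option.some.inj this
    have hTω' := hi₀T ω'
    have hfω' : f (ω', k') = Function.update ω'.1 (i₀ ω) (eqv ⟨i₀ ω, hi₀T ω⟩ k') := by
      simp only [f]
      have : ∀ (j : I) (hj : j ∈ T), j = i₀ ω →
          Function.update ω'.1 j (eqv ⟨j, hj⟩ k') =
            Function.update ω'.1 (i₀ ω) (eqv ⟨i₀ ω, hi₀T ω⟩ k') := by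
        rintro _ hj rfl
        rfl
      exact this _ _ hi.symm
    rw [hfω'] at h
    have hk : k = k' := by
      have h1 := congrFun h (i₀ ω)
      simp only [f, Function.update_self] at h1
      exact (eqv _).injective h1
    have hother : ∀ i ≠ i₀ ω, ω.1 i = ω'.1 i := by
      intro i hne
      have h1 := congrFun h i
      simpa [f, Function.update_of_ne hne] using h1
    have hsum : ∑ i ∈ T, γ ω i * val i (ω.1 i) = ∑ i ∈ T, γ ω i * val i (ω'.1 i) := by
      rw [← ω.2.2, hα _ _ hoff, ω'.2.2, hγ']
    rw [← Finset.add_sum_erase _ _ (hi₀T ω),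
      ← Finset.add_sum_erase _ (fun i => γ ω i * val i (ω'.1 i)) (hi₀T ω),
      Finset.sum_congr rfl (g := fun i => γ ω i * val i (ω'.1 i))
        (fun i hi => by rw [hother i (Finset.ne_of_mem_erase hi)])] at hsum
    have h2 := hval _ (mul_left_cancel₀ (hi₀ ω) (add_right_cancel hsum))
    refine Prod.ext (Subtype.ext (funext fun i => ?_)) hk
    by_cases hne : i = i₀ ω
    · rw [hne]; exact h2
    · exact hother i hne
  simpa [Nat.card_prod] using Nat.card_le_card_of_injective f hf

/-! ### Fixing the coefficients of one coding node -/

namespace MultiDigraph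

variable {V E ι : Type*} (G : MultiDigraph V E) (F : Type*) [Field F]

open Classical in
/-- The coefficients where those of the coding nodes in `P` are given by `x`, those of the other
coding nodes are generic, and the other nodes broadcast. -/
noncomputable def mixedCoeff (P : Set V) (x : E → F) (e : E) : GenericField E F :=
  if G.IsCodingNode (G.head e) then
    if G.head e ∈ P then algebraMap F _ (x e) else genericVar F e
  else 1

variable {G F} [Fintype V] [Fintype E] {src : ι → V}

/-- The generic nodes are the coding nodes outside `P`. A non-coding node has at most one incoming
edge, with coefficient 1, so it only forwards. -/
theorem hasTightCut_mixedCoeff [Finite ι] (hG : G.Acyclic)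
    (hin : ∀ v, {e | G.head e = v}.ncard ≤ 2) (hsrc : ∀ e i, G.head e ≠ src i)
    {P : Set V} {x : E → F} {y : V → ι → GenericField E F}
    (hy : G.IsEncoding src (G.mixedCoeff F P x) y)
    (hP : ∀ B ⊆ P ∪ {v | ∃ e, G.tail e = v ∧ G.head e ∈ P}, G.HasTightCut src y B)
    (B : Set V) : G.HasTightCut src y B := by
  classical
  refine hy.hasTightCut (U := {v | G.IsCodingNode v ∧ v ∉ P}) hG ?_ ?_ hsrc hP B
  · rintro e₀ ⟨h1, h2⟩
    obtain ⟨σ, hσ₀, hσ, hσF⟩ := exists_shift F e₀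
    refine ⟨σ, ?_, fun e he => ?_⟩
    · simp only [mixedCoeff, if_pos h1, if_neg h2, hσ₀]
    · simp only [mixedCoeff]
      split_ifs
      · exact hσF _
      · exact hσ e he
      · exact map_one σ
  · intro e heP heU
    have hcod : ¬ G.IsCodingNode (G.head e) := fun h => heU ⟨h, heP⟩
    refine ⟨by simp [mixedCoeff, hcod], fun e' he' => ?_⟩
    have h1 : {e' | G.head e' = G.head e}.ncard ≤ 1 := by
      have := hin (G.head e)
      have h2 : {e' | G.head e' = G.head e}.ncard ≠ 2 := hcod
      omega
    exact (Set.ncard_le_one (Set.toFinite _)).1 h1 e' he' e rfl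

/-- If the encoding vectors `y` have full rank and `y'` do not, then some independent nodes
become dependent. -/
theorem exists_not_linearIndepOn_of_not_hasTightCut [Fintype ι] {K : Type*} [Field K] {c : E → K}
    {y y' : V → ι → K} (hy : G.IsEncoding src c y) {B : Set V}
    (hB : G.HasTightCut src y B) (hB' : ¬ G.HasTightCut src y' B) :
    ∃ S : Finset V, (S : Set V) ⊆ B ∪ Set.range src ∧ S.card = Fintype.card ι ∧
      LinearIndepOn K y (S : Set V) ∧ ¬ LinearIndepOn K y' (S : Set V) := by
  classical
  -- A basis `I` chosen inside `B` is completed by sources. If the completed set stayed independent,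
  -- so would `I`, and the old cut would remain tight.
  obtain ⟨I, hIB, -, hIspan, hI⟩ := exists_linearIndepOn_extension
    (linearIndepOn_empty K y) (Set.empty_subset B)
  obtain ⟨S, hSB, hIS, hSspan, hS⟩ := exists_linearIndepOn_extension hI
    (hIB.trans (Set.subset_union_left (t := Set.range src)))
  have htop : Submodule.span K (y '' S) = ⊤ := by
    rw [eq_top_iff, ← (Pi.basisFun K ι).span_eq, Submodule.span_le]
    rintro _ ⟨i, rfl⟩
    rw [Pi.basisFun_apply, ← hy.source]
    exact hSspan ⟨src i, .inr ⟨i, rfl⟩, rfl⟩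
  refine ⟨S.toFinset, by simpa using hSB, ?_, by simpa using hS, fun hS' => hB' ?_⟩
  · have h1 := linearIndependent_iff_card_eq_finrank_span.1 hS
    rw [Set.finrank] at h1
    have : Set.range (fun v : S => y v) = y '' S := by rw [Set.image_eq_range]
    rw [this, htop, finrank_top, Module.finrank_fintype_fun_eq_card] at h1
    rw [Set.toFinset_card, h1]
  · obtain ⟨C, hC, hcard⟩ := hB
    refine ⟨C, hC, hcard.trans ?_⟩
    have h1 : Module.finrank K (Submodule.span K (y '' B)) ≤ Fintype.card I := by
      have h2 := linearIndependent_iff_card_eq_finrank_span.1 hI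
      rw [h2, Set.finrank]
      refine Submodule.finrank_mono ?_
      have : Set.range (fun v : I => y v) = y '' I := by rw [Set.image_eq_range]
      rw [this, Submodule.span_le]
      exact hIspan
    have hI' : LinearIndepOn K y' I := by
      rw [Set.coe_toFinset] at hS'
      exact hS'.mono hIS
    have h3 := linearIndependent_iff_card_eq_finrank_span.1 hI'
    rw [h3, Set.finrank] at h1
    refine h1.trans (Submodule.finrank_mono (Submodule.span_mono ?_))
    rintro _ ⟨v, rfl⟩
    exact ⟨v, hIB v.2, rfl⟩

open Classical in
theorem det_mixedCoeff_congr {P : Set V} {v : V} {x x' : E → F}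
    (h : ∀ e, G.IsCodingNode (G.head e) → G.head e ≠ v → x e = x' e) (s : ι → V)
    (z : V → GenericField E F) :
    ((G.equationMatrix src (G.mixedCoeff F P x) s).updateRow v z).det =
      ((G.equationMatrix src (G.mixedCoeff F (insert v P) x') s).updateRow v z).det := by
  rw [equationMatrix_updateRow_congr]
  intro e he
  simp only [mixedCoeff, Set.mem_insert_iff, he, false_or]
  split_ifs with h1
  · rw [h e h1 he]
  · rfl
  · rfl

open Classical in
/-- Drawing the coefficients of one coding node makes given independent nodes dependent with
probability at most `1 / q`. -/
theorem card_dependent_mul_le {P : Set V} {v : V} (hv : G.IsCodingNode v)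
    (hvs : v ∉ Set.range src) (s : ι → V)
    {B : {e : E // G.IsCodingNode (G.head e)} → Type*} [∀ i, Finite (B i)]
    (val : ∀ i, B i → F) (hval : ∀ i, Function.Injective (val i)) (q : ℕ)
    (hq : ∀ i, G.head i.1 = v → Nat.card (B i) = q) (x : (∀ i, B i) → E → F)
    (hx : ∀ ω e (h : G.IsCodingNode (G.head e)), x ω e = val ⟨e, h⟩ (ω ⟨e, h⟩)) :
    {ω : ∀ i, B i | (G.equationMatrix src (G.mixedCoeff F P (x ω)) s).det ≠ 0 ∧
      (G.equationMatrix src (G.mixedCoeff F (insert v P) (x ω)) s).det = 0}.ncard * q ≤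
      Nat.card (∀ i, B i) := by
  have hsum : ∀ f : E → GenericField E F, ∑ e with G.head e = v, f e =
      ∑ i : {e : E // G.IsCodingNode (G.head e)} with G.head i.1 = v, f i := by
    intro f
    refine Eq.trans ?_ (Finset.sum_map _ (Function.Embedding.subtype _) f)
    refine Finset.sum_congr (Finset.ext fun e => ?_) fun _ _ => rfl
    simp only [Finset.mem_filter, Finset.mem_univ, true_and, Finset.mem_map,
      Function.Embedding.subtype_apply, Subtype.exists, exists_and_left, exists_prop,
      exists_eq_right_right]
    exact ⟨fun h => ⟨h, by rw [h]; exact hv⟩, fun h => h.1⟩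
  refine le_trans (Nat.mul_le_mul_right q (Set.ncard_le_ncard ?_ (Set.toFinite _)))
    (card_linear_equation_mul_le
      (fun i b => algebraMap F (GenericField E F) (val i b))
      (fun i => (algebraMap F (GenericField E F)).injective.comp (hval i))
      (Finset.univ.filter fun i => G.head i.1 = v) q (fun i hi => hq i (Finset.mem_filter.1 hi).2)
      (fun ω => ((G.equationMatrix src (G.mixedCoeff F (insert v P) (x ω)) s).updateRow v
        (Pi.single v 1)).det)
      (fun ω i => ((G.equationMatrix src (G.mixedCoeff F (insert v P) (x ω)) s).updateRow v
        (Pi.single (G.tail i.1) 1)).det) ?_ ?_)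
  · rintro ω ⟨h1, h2⟩
    rw [det_equationMatrix _ hvs, sub_eq_zero, hsum] at h2
    have hα : ((G.equationMatrix src (G.mixedCoeff F (insert v P) (x ω)) s).updateRow v
        (Pi.single v 1)).det = ∑ i : {e : E // G.IsCodingNode (G.head e)} with G.head i.1 = v,
        ((G.equationMatrix src (G.mixedCoeff F (insert v P) (x ω)) s).updateRow v
          (Pi.single (G.tail i.1) 1)).det * algebraMap F (GenericField E F) (val i (ω i)) := by
      rw [h2]
      refine Finset.sum_congr rfl fun i hi => ?_
      rw [mul_comm, ← hx ω i.1 i.2]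
      congr 1
      rw [mixedCoeff, if_pos i.2, if_pos (.inl (Finset.mem_filter.1 hi).2)]
    refine ⟨?_, hα⟩
    -- If all cofactors vanished, so would the constant term. The determinant would then be zero
    -- already for generic coefficients at `v`, as neither the cofactors nor the constant term
    -- depend on them.
    by_contra! hall
    refine h1 ?_
    rw [det_equationMatrix _ hvs, sub_eq_zero, hsum]
    rw [det_mixedCoeff_congr (P := P) (x := x ω) (fun _ _ _ => rfl), hα]
    refine Finset.sum_congr rfl fun i hi => ?_
    rw [det_mixedCoeff_congr (P := P) (x := x ω) (fun _ _ _ => rfl), hall i hi, zero_mul, mul_zero]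
  · intro ω ω' h
    rw [equationMatrix_updateRow_congr (c' := G.mixedCoeff F (insert v P) (x ω'))]
    intro e he
    simp only [mixedCoeff]
    split_ifs with h1
    · rw [hx ω e h1, hx ω' e h1, h ⟨e, h1⟩ (by simp [he])]
    · rfl
    · rfl
  · intro ω ω' h
    funext i
    rw [equationMatrix_updateRow_congr (c' := G.mixedCoeff F (insert v P) (x ω'))]
    intro e he
    simp only [mixedCoeff]
    split_ifs with h1
    · rw [hx ω e h1, hx ω' e h1, h ⟨e, h1⟩ (by simp [he])]
    · rfl
    · rfl

end MultiDigraph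

/-! ### Counting nodes by depth -/

namespace MultiDigraph

variable {V E ι : Type*} {G : MultiDigraph V E}

section Count

variable (G)

/-- The nodes at the end of a walk with exactly `n` edges from a node of `S`. -/
def layer (S : Set V) (n : ℕ) : Set V := {v | ∃ s ∈ S, G.HasWalk n s v}

/-- The coding nodes that can be reached from `S`. -/
def reachableCoding (S : Set V) : Set V := {v | G.IsCodingNode v ∧ ∃ n, v ∈ G.layer S n}

/-- The nodes of `S` together with the coding nodes of depth at most `n` and their in-neighbours. -/
def window (S : Set V) (n : ℕ) : Set V :=
  S ∪ {v | v ∈ G.reachableCoding S ∧ G.depth S v ≤ n} ∪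
    {u | ∃ e, G.tail e = u ∧ G.head e ∈ G.reachableCoding S ∧ G.depth S (G.head e) ≤ n}

variable {G} {S : Set V}

theorem layer_zero : G.layer S 0 = S := by
  ext v
  constructor
  · rintro ⟨s, hs, p, rfl, rfl, -⟩
    exact hs
  · exact fun hv => ⟨v, hv, fun _ => v, rfl, rfl, by simp⟩

theorem mem_layer_succ {n : ℕ} {v : V} :
    v ∈ G.layer S (n + 1) ↔ ∃ u ∈ G.layer S n, G.Adj u v := by
  constructor
  · rintro ⟨s, hs, p, h0, rfl, hp⟩
    exact ⟨p n, ⟨s, hs, p, h0, rfl, fun k hk => hp k (by omega)⟩, hp n (by omega)⟩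
  · rintro ⟨u, ⟨s, hs, p, h0, rfl, hp⟩, huv⟩
    refine ⟨s, hs, fun k => if k ≤ n then p k else v, by simpa using h0, by simp, fun k hk => ?_⟩
    rcases Nat.lt_succ_iff_lt_or_eq.1 hk with h | rfl
    · simpa [h.le, Nat.succ_le_of_lt h] using hp k h
    · simpa using huv

theorem mem_layer_depth {v : V} {n : ℕ} (hv : v ∈ G.layer S n) :
    v ∈ G.layer S (G.depth S v) :=
  Nat.sInf_mem (s := {n | ∃ s ∈ S, G.HasWalk n s v}) ⟨n, hv⟩

theorem ncard_layer_le [Finite V] [Finite E] (hout : ∀ v, {e | G.tail e = v}.ncard ≤ 2) (n : ℕ) :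
    (G.layer S n).ncard ≤ S.ncard * 2 ^ n := by
  classical
  have := Fintype.ofFinite V
  induction n with
  | zero => simp [layer_zero]
  | succ n ih =>
    have hsub : G.layer S (n + 1) ⊆
        ⋃ u ∈ (G.layer S n).toFinset, G.head '' {e | G.tail e = u} := by
      intro v hv
      obtain ⟨u, hu, e, rfl, rfl⟩ := mem_layer_succ.1 hv
      exact Set.mem_biUnion (by simpa using hu) ⟨e, rfl, rfl⟩
    calc (G.layer S (n + 1)).ncard
        ≤ (⋃ u ∈ (G.layer S n).toFinset, G.head '' {e | G.tail e = u}).ncard :=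
          Set.ncard_le_ncard hsub (Set.toFinite _)
      _ ≤ ∑ u ∈ (G.layer S n).toFinset, (G.head '' {e | G.tail e = u}).ncard :=
          Finset.set_ncard_biUnion_le _ _
      _ ≤ ∑ u ∈ (G.layer S n).toFinset, 2 :=
          Finset.sum_le_sum fun u _ => (Set.ncard_image_le (Set.toFinite _)).trans (hout u)
      _ = (G.layer S n).ncard * 2 := by
          rw [Finset.sum_const, smul_eq_mul, Set.ncard_eq_toFinset_card']
      _ ≤ S.ncard * 2 ^ (n + 1) := by
          rw [pow_succ, ← mul_assoc]
          exact Nat.mul_le_mul_right 2 ih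

theorem ncard_biUnion_layer_le [Finite V] [Finite E]
    (hout : ∀ v, {e | G.tail e = v}.ncard ≤ 2) (n : ℕ) :
    (⋃ k ∈ Finset.range (n + 1), G.layer S k).ncard ≤ S.ncard * 2 ^ (n + 1) := by
  refine (Finset.set_ncard_biUnion_le _ _).trans
    ((Finset.sum_le_sum fun k _ => ncard_layer_le hout k).trans ?_)
  rw [← Finset.mul_sum]
  exact Nat.mul_le_mul_left _ (Nat.geomSum_lt le_rfl (by simp)).le

theorem ncard_window_le [Finite V] [Finite E] (hout : ∀ v, {e | G.tail e = v}.ncard ≤ 2)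
    (hS : ∀ e, G.head e ∉ S) (n : ℕ) :
    (G.window S n).ncard ≤ 2 * (S.ncard * 2 ^ (n + 1)) := by
  classical
  set ball := ⋃ k ∈ Finset.range (n + 1), G.layer S k with hball
  set N := {v | v ∈ G.reachableCoding S ∧ G.depth S v ≤ n} with hN
  have hNball : N ⊆ ball := by
    rintro v ⟨⟨-, k, hk⟩, hv⟩
    exact Set.mem_biUnion (x := G.depth S v) (by simpa [Nat.lt_succ_iff] using hv)
      (mem_layer_depth hk)
  -- One in-neighbour of a coding node precedes it on a shortest path and is already in the ball, so
  -- each coding node adds at most one new node.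
  have hother : ∀ v ∈ N, ∃ w, ∀ e, G.head e = v → G.tail e ∈ ball ∨ G.tail e = w := by
    rintro v ⟨⟨hcod, k, hk⟩, hv⟩
    obtain ⟨e₁, e₂, -, he⟩ := Set.ncard_eq_two.1 hcod
    have hdep := mem_layer_depth hk
    obtain ⟨m, hm⟩ : ∃ m, G.depth S v = m + 1 := by
      refine Nat.exists_eq_succ_of_ne_zero fun h0 => ?_
      rw [h0, layer_zero] at hdep
      have : G.head e₁ = v := (he ▸ Set.mem_insert e₁ {e₂} : e₁ ∈ {e | G.head e = v})
      exact hS e₁ (this ▸ hdep)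
    rw [hm, mem_layer_succ] at hdep
    obtain ⟨u, hu, e, rfl, hev⟩ := hdep
    have hub : G.tail e ∈ ball :=
      Set.mem_biUnion (x := m) (by simp; omega) hu
    have hmem : ∀ e', G.head e' = v → e' = e₁ ∨ e' = e₂ := fun e' he' => by
      have : e' ∈ {e | G.head e = v} := he'
      rw [he] at this
      simpa using this
    rcases hmem e hev with rfl | rfl
    · refine ⟨G.tail e₂, fun e' he' => ?_⟩
      rcases hmem e' he' with rfl | rfl
      · exact .inl hub
      · exact .inr rfl
    · refine ⟨G.tail e₁, fun e' he' => ?_⟩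
      rcases hmem e' he' with rfl | rfl
      · exact .inr rfl
      · exact .inl hub
  choose! other hother using hother
  have hsub : G.window S n ⊆ ball ∪ other '' N := by
    rintro v ((hv | hv) | ⟨e, rfl, h⟩)
    · exact .inl (Set.mem_biUnion (x := 0) (by simp) (by rwa [layer_zero]))
    · exact .inl (hNball hv)
    · rcases hother _ h e rfl with h' | h'
      · exact .inl h'
      · exact .inr ⟨_, h, h'.symm⟩
  have h1 := ncard_biUnion_layer_le (S := S) hout n
  rw [← hball] at h1
  have h2 : (other '' N).ncard ≤ ball.ncard :=
    (Set.ncard_image_le (Set.toFinite _)).trans (Set.ncard_le_ncard hNball (Set.toFinite _))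
  have h3 := (Set.ncard_le_ncard hsub (Set.toFinite _)).trans (Set.ncard_union_le _ _)
  omega

end Count

/-! ### Fixing the coding nodes one after the other -/

section Induction

theorem exists_enum [Fintype ι] (S : Finset V) (hS : S.card = Fintype.card ι) :
    ∃ s : ι → V, Function.Injective s ∧ Set.range s = S := by
  classical
  have e : ι ≃ S := Fintype.equivOfCardEq (by simp [hS])
  refine ⟨fun i => e i, Subtype.val_injective.comp e.injective, ?_⟩
  ext v
  constructor
  · rintro ⟨i, rfl⟩
    exact (e i).2
  · exact fun hv => ⟨e.symm ⟨v, hv⟩, by simp⟩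

variable {F : Type*} [Field F] [Fintype V] [Fintype E] [Fintype ι] {src : ι → V}

open Classical in
/-- If no step of fixing the coefficients of the coding nodes, in the order `idx`, makes independent
nodes dependent, then every set of nodes has a tight cut. -/
theorem hasTightCut_of_forall_det (hG : G.Acyclic) (hinj : Function.Injective src)
    (hin : ∀ v, {e | G.head e = v}.ncard ≤ 2) (hsrc : ∀ e i, G.head e ≠ src i)
    {N : Set V} {idx : V → ℕ} (hidx : Set.InjOn idx N) (Q : V → Set V)
    (hQsrc : ∀ v ∈ N, Set.range src ⊆ Q v)
    (hQ : ∀ v ∈ N, ∀ u ∈ N, idx u ≤ idx v → u ∈ Q v ∧ ∀ e, G.head e = u → G.tail e ∈ Q v)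
    (enum : Finset V → ι → V)
    (henum : ∀ S : Finset V, S.card = Fintype.card ι →
      Function.Injective (enum S) ∧ Set.range (enum S) = S) (x : E → F)
    (hx : ∀ v ∈ N, ∀ S : Finset V, (S : Set V) ⊆ Q v → S.card = Fintype.card ι →
      (G.equationMatrix src (G.mixedCoeff F {u | u ∈ N ∧ idx u < idx v} x) (enum S)).det ≠ 0 →
      (G.equationMatrix src (G.mixedCoeff F (insert v {u | u ∈ N ∧ idx u < idx v}) x)
        (enum S)).det ≠ 0) (k : ℕ) {y : V → ι → GenericField E F}
    (hy : G.IsEncoding src (G.mixedCoeff F {u | u ∈ N ∧ idx u < k} x) y) (B : Set V) :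
    G.HasTightCut src y B := by
  induction k generalizing y B with
  | zero =>
    -- With nothing fixed, only the empty set has to be checked.
    refine hasTightCut_mixedCoeff hG hin hsrc hy (fun B hB => ⟨∅, fun v hv => ?_, by simp⟩) B
    rcases hB hv with h | ⟨e, -, h⟩
    · exact absurd h.2 (by simp)
    · exact absurd h.2 (by simp)
  | succ k ih =>
    by_cases hex : ∃ v ∈ N, idx v = k
    · obtain ⟨v, hvN, rfl⟩ := hex
      have hP : {u | u ∈ N ∧ idx u < idx v + 1} = insert v {u | u ∈ N ∧ idx u < idx v} := by
        ext u
        constructor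
        · rintro ⟨huN, hu⟩
          rcases Nat.lt_succ_iff_lt_or_eq.1 hu with h | h
          · exact .inr ⟨huN, h⟩
          · exact .inl (hidx huN hvN h)
        · rintro (rfl | ⟨huN, hu⟩)
          · exact ⟨hvN, Nat.lt_succ_self _⟩
          · exact ⟨huN, by omega⟩
      refine hasTightCut_mixedCoeff hG hin hsrc hy (fun B hB => ?_) B
      obtain ⟨y₀, hy₀⟩ := hG.exists_isEncoding hinj
        (G.mixedCoeff F {u | u ∈ N ∧ idx u < idx v} x)
      by_contra hcon
      obtain ⟨S, hSB, hScard, hS, hS'⟩ :=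
        exists_not_linearIndepOn_of_not_hasTightCut hy₀ (ih hy₀ B) hcon
      have hBQ : B ⊆ Q v := by
        intro w hw
        rcases hB hw with h | ⟨e, rfl, h⟩
        · exact (hQ v hvN w h.1 (Nat.lt_succ_iff.1 h.2)).1
        · exact (hQ v hvN _ h.1 (Nat.lt_succ_iff.1 h.2)).2 e rfl
      obtain ⟨hsinj, hsrange⟩ := henum S hScard
      rw [hP] at hy
      have h1 := hx v hvN S (hSB.trans (Set.union_subset hBQ (hQsrc v hvN))) hScard
      rw [Ne, hy₀.det_equationMatrix_eq_zero_iff hG hinj, not_not, Ne,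
        hy.det_equationMatrix_eq_zero_iff hG hinj, not_not] at h1
      rw [← hsrange, linearIndepOn_range_iff hsinj] at hS hS'
      exact hS' (h1 hS)
    · refine ih ?_ B
      convert hy using 3
      ext u
      constructor
      · exact fun h => ⟨h.1, h.2.trans (Nat.lt_succ_self k)⟩
      · exact fun h => ⟨h.1, lt_of_le_of_ne (Nat.lt_succ_iff.1 h.2) fun h' => hex ⟨u, h.1, h'⟩⟩

theorem IsEncoding.exists_mem_layer_of_ne_zero {K : Type*} [Field K] (hG : G.Acyclic) {c : E → K}
    {y : V → ι → K} (hy : G.IsEncoding src c y) {v : V} (hv : y v ≠ 0) :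
    ∃ n, v ∈ G.layer (Set.range src) n := by
  classical
  obtain ⟨τ, hτ⟩ := hG.exists_rank
  induction hn : τ v using Nat.strong_induction_on generalizing v with
  | _ n ih =>
    by_cases hs : v ∈ Set.range src
    · exact ⟨0, by rwa [layer_zero]⟩
    · rw [hy.node v hs] at hv
      obtain ⟨e, he, hne⟩ := Finset.exists_ne_zero_of_sum_ne_zero hv
      obtain rfl := (Finset.mem_filter.1 he).2
      obtain ⟨m, hm⟩ := ih _ (hn ▸ hτ _ _ ⟨e, rfl, rfl⟩) (right_ne_zero_of_smul hne) rfl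
      exact ⟨m + 1, mem_layer_succ.2 ⟨_, hm, e, rfl, rfl⟩⟩

/-- The messages can be recovered from the packets of a set of nodes that is well connected to the
sources if it has a tight cut when the coefficients of all reachable coding nodes are fixed. -/
theorem IsEncoding.eq_zero_of_hasTightCut (hG : G.Acyclic) {c x : E → F}
    (hc : ∀ e, G.IsCodingNode (G.head e) → c e = x e)
    (hc' : ∀ e, ¬ G.IsCodingNode (G.head e) → c e = 1)
    {y : V → ι → F} (hy : G.IsEncoding src c y) {y' : V → ι → GenericField E F}
    (hy' : G.IsEncoding src (G.mixedCoeff F (G.reachableCoding (Set.range src)) x) y')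
    {B : Set V} (hB : G.HasTightCut src y' B)
    (hconn : ∀ C : Finset V, (∀ v ∈ B, ¬ G.Reach src C v) → Fintype.card ι ≤ C.card)
    {X : ι → F} (hX : ∀ v ∈ B, y v ⬝ᵥ X = 0) : X = 0 := by
  classical
  set f := algebraMap F (GenericField E F) with hf
  have hmap : G.IsEncoding src (fun e => f (c e)) (fun v i => f (y v i)) := by
    refine ⟨fun i => ?_, fun v hv => ?_⟩
    · funext j
      simp only [hy.source, Pi.single_apply]
      split_ifs <;> simp
    · funext j
      simp [hy.node v hv, Finset.sum_apply]
  -- The two codes differ only at unreachable coding nodes, all of whose incoming vectors are zero.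
  have heq : (fun v i => f (y v i)) = y' := by
    refine hmap.ext_of_eq hG hy' fun e he => ?_
    obtain ⟨n, hn⟩ := hmap.exists_mem_layer_of_ne_zero hG he
    simp only [mixedCoeff]
    split_ifs with h1 h2
    · rw [hc e h1]
    · exact absurd ⟨h1, n + 1, mem_layer_succ.2 ⟨_, hn, e, rfl, rfl⟩⟩ h2
    · rw [hc' e h1, map_one]
  obtain ⟨C, hC, hcard⟩ := hB
  have htop : Submodule.span (GenericField E F) (y' '' B) = ⊤ := by
    refine Submodule.eq_top_of_finrank_eq (le_antisymm (Submodule.finrank_le _) ?_)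
    rw [Module.finrank_fintype_fun_eq_card]
    exact (hconn C hC).trans hcard
  let φ : (ι → GenericField E F) →ₗ[GenericField E F] GenericField E F :=
    { toFun := fun z => z ⬝ᵥ fun i => f (X i)
      map_add' := fun a b => add_dotProduct _ _ _
      map_smul' := fun r a => smul_dotProduct _ _ _ }
  have hker : Submodule.span (GenericField E F) (y' '' B) ≤ LinearMap.ker φ := by
    rw [Submodule.span_le]
    rintro _ ⟨v, hv, rfl⟩
    rw [SetLike.mem_coe, LinearMap.mem_ker, ← heq]
    change ∑ i, f (y v i) * f (X i) = 0
    rw [← map_zero f, ← hX v hv, dotProduct, map_sum]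
    exact Finset.sum_congr rfl fun i _ => (map_mul f _ _).symm
  funext i
  have h1 : φ (Pi.single i 1) = 0 := LinearMap.mem_ker.1 (hker (htop ▸ Submodule.mem_top))
  have h2 : φ (Pi.single i 1) = f (X i) := by
    change Pi.single i 1 ⬝ᵥ _ = _
    rw [single_dotProduct, one_mul]
  rw [h2] at h1
  exact (map_eq_zero f).1 h1

end Induction

end MultiDigraph

/-! ### Numerical estimates -/

theorem two_pow_le_two_mul_factorial {R : ℕ} (hR : 1 ≤ R) : 2 ^ R ≤ 2 * R.factorial := by
  induction R, hR using Nat.le_induction with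
  | base => simp
  | succ n hn ih =>
    rw [pow_succ, Nat.factorial_succ]
    calc 2 ^ n * 2 ≤ 2 * n.factorial * (n + 1) := Nat.mul_le_mul ih (by omega)
      _ = 2 * ((n + 1) * n.factorial) := by ring

/-- The factorial in the binomial coefficient absorbs the factor `2 ^ R` of `(2 * m) ^ R`, up to 2.
-/
theorem choose_two_mul_le {R n m : ℕ} (hR : 1 ≤ R) (hn : n ≤ 2 * m) : n.choose R ≤ 2 * m ^ R := by
  have h1 : (n.choose R : ℝ) ≤ (2 * m : ℕ) ^ R / R.factorial :=
    (Nat.choose_le_pow_div R n).trans (by gcongr)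
  have h2 : ((2 ^ R : ℕ) : ℝ) ≤ ((2 * R.factorial : ℕ) : ℝ) :=
    Nat.cast_le.2 (two_pow_le_two_mul_factorial hR)
  have h3 : ((2 * m : ℕ) : ℝ) ^ R / R.factorial ≤ 2 * m ^ R := by
    rw [div_le_iff₀ (by positivity)]
    push_cast at h2 ⊢
    rw [mul_pow]
    calc (2 : ℝ) ^ R * m ^ R ≤ 2 * R.factorial * m ^ R := by gcongr
      _ = 2 * m ^ R * R.factorial := by ring
  exact_mod_cast h1.trans h3

theorem card_boundedPoly (d : ℤ) : Nat.card (boundedPoly d) = 2 ^ (d + 1).toNat := by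
  rw [Nat.card_congr (Polynomial.degreeLTEquiv (ZMod 2) (d + 1).toNat).toEquiv]
  simp

/-- The left side is `2 ^ r`, where the degree bound is the ceiling of `r - 1`; there are `2 ^ (d +
1)` polynomials of degree at most `d`. A negative bound is harmless, as `toNat` only increases the
exponent. -/
theorem le_card_boundedPoly_supDegree {ε : ℝ} (hε : 0 < ε) {R : ℕ} (hR : 1 ≤ R) (Δ : ℕ) :
    ((R * 2 ^ (Δ + 1) : ℕ) : ℝ) ^ (R + 1) * 2 ^ Δ / ε ≤
      Nat.card (boundedPoly (supDegree ε R Δ)) := by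
  have hR0 : (0 : ℝ) < R := by exact_mod_cast hR
  rw [card_boundedPoly]
  set r : ℝ := ((R : ℝ) + 1) * (Δ + 1 + Real.logb 2 R) + Δ + Real.logb 2 (1 / ε) with hr
  have h1 : ((R * 2 ^ (Δ + 1) : ℕ) : ℝ) ^ (R + 1) * 2 ^ Δ / ε = (2 : ℝ) ^ r := by
    have hlog : (2 : ℝ) ^ (Δ + 1 + Real.logb 2 R) = R * 2 ^ (Δ + 1) := by
      rw [Real.rpow_add two_pos, Real.rpow_logb two_pos (by norm_num) hR0, mul_comm]
      congr 1
      exact_mod_cast Real.rpow_natCast 2 (Δ + 1)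
    rw [hr, Real.rpow_add two_pos, Real.rpow_add two_pos, mul_comm ((R : ℝ) + 1),
      Real.rpow_mul two_pos.le, hlog, Real.rpow_logb two_pos (by norm_num) (by positivity),
      Real.rpow_natCast]
    have : ((R : ℝ) + 1) = ((R + 1 : ℕ) : ℝ) := by push_cast; rfl
    rw [this, Real.rpow_natCast]
    push_cast
    ring
  have h2 : r ≤ ((supDegree ε R Δ + 1).toNat : ℝ) := by
    have h3 : r - 1 ≤ supDegree ε R Δ := Int.le_ceil _
    have h4 : ((supDegree ε R Δ + 1 : ℤ) : ℝ) ≤ ((supDegree ε R Δ + 1).toNat : ℤ) :=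
      Int.cast_le.2 (Int.self_le_toNat _)
    push_cast at h4
    linarith
  rw [h1]
  push_cast
  rw [← Real.rpow_natCast]
  exact Real.rpow_le_rpow_of_exponent_le one_le_two h2

theorem choose_div_le {ε q : ℝ} (hε : 0 < ε) {R Δ n : ℕ} (hR : 1 ≤ R)
    (hn : n ≤ 2 * (R * 2 ^ (Δ + 1)))
    (hq : ((R * 2 ^ (Δ + 1) : ℕ) : ℝ) ^ (R + 1) * 2 ^ Δ / ε ≤ q) :
    (n.choose R : ℝ) / q ≤ ε / (R * 2 ^ Δ * 2 ^ Δ) := by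
  have hR0 : (0 : ℝ) < R := by exact_mod_cast hR
  have hm : (0 : ℝ) < ((R * 2 ^ (Δ + 1) : ℕ) : ℝ) := by push_cast; positivity
  set m : ℝ := ((R * 2 ^ (Δ + 1) : ℕ) : ℝ) with hmdef
  have hch : (n.choose R : ℝ) ≤ 2 * m ^ R := by
    rw [hmdef]
    exact_mod_cast choose_two_mul_le hR hn
  have hpos : 0 < m ^ (R + 1) * 2 ^ Δ / ε := by positivity
  calc (n.choose R : ℝ) / q ≤ (2 * m ^ R) / (m ^ (R + 1) * 2 ^ Δ / ε) := by gcongr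
    _ = 2 * ε / (m * 2 ^ Δ) := by
      rw [pow_succ]
      field_simp
    _ = ε / (R * 2 ^ Δ * 2 ^ Δ) := by
      rw [hmdef]
      push_cast
      rw [pow_succ]
      field_simp

/-- The nodes of depth `k` contribute at most `ε / 2 ^ k`. Excluding depth 0 matters: the series
from `k = 1` has sum `ε`, from `k = 0` it would be `2 * ε`. -/
theorem sum_depth_le {V : Type*} {ε : ℝ} (hε : 0 < ε) {R : ℕ} (hR : 1 ≤ R) (N : Finset V)
    (d : V → ℕ) (hd : ∀ v ∈ N, d v ≠ 0)
    (hN : ∀ k, (N.filter fun v => d v = k).card ≤ R * 2 ^ k) :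
    ∑ v ∈ N, ε / (R * 2 ^ d v * 2 ^ d v) ≤ ε := by
  classical
  have hR0 : (0 : ℝ) < R := by exact_mod_cast hR
  obtain ⟨M, hM⟩ : ∃ M, ∀ v ∈ N, d v < M :=
    ⟨N.sup d + 1, fun v hv => Nat.lt_succ_of_le (Finset.le_sup hv)⟩
  have hgeom : ∀ M : ℕ, ∑ k ∈ Finset.range M, (ε / 2 ^ (k + 1)) = ε - ε / 2 ^ M := by
    intro M
    induction M with
    | zero => simp
    | succ M ih =>
      rw [Finset.sum_range_succ, ih, pow_succ]
      field_simp
      ring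
  have hmaps : ∀ v ∈ N, d v - 1 ∈ Finset.range M := fun v hv => by
    have := hM v hv
    simp
    omega
  rw [← Finset.sum_fiberwise_of_maps_to hmaps]
  calc ∑ k ∈ Finset.range M, ∑ v ∈ N with d v - 1 = k, ε / (R * 2 ^ d v * 2 ^ d v)
      ≤ ∑ k ∈ Finset.range M, ε / 2 ^ (k + 1) := by
        refine Finset.sum_le_sum fun k _ => ?_
        have h1 : ∀ v ∈ N.filter (fun v => d v - 1 = k),
            ε / (R * 2 ^ d v * 2 ^ d v) = ε / (R * 2 ^ (k + 1) * 2 ^ (k + 1)) := by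
          intro v hv
          have h2 := Finset.mem_filter.1 hv
          have h3 := hd v h2.1
          rw [show d v = k + 1 by omega]
        rw [Finset.sum_congr rfl h1, Finset.sum_const, nsmul_eq_mul]
        have h4 : ((N.filter fun v => d v - 1 = k).card : ℝ) ≤ R * 2 ^ (k + 1) := by
          have h5 : (N.filter fun v => d v - 1 = k) ⊆ N.filter fun v => d v = k + 1 := by
            intro v hv
            have h2 := Finset.mem_filter.1 hv
            have h3 := hd v h2.1
            exact Finset.mem_filter.2 ⟨h2.1, by omega⟩
          exact_mod_cast (Finset.card_le_card h5).trans (hN (k + 1))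
        calc ((N.filter fun v => d v - 1 = k).card : ℝ) * (ε / (R * 2 ^ (k + 1) * 2 ^ (k + 1)))
            ≤ R * 2 ^ (k + 1) * (ε / (R * 2 ^ (k + 1) * 2 ^ (k + 1))) := by gcongr
          _ = ε / 2 ^ (k + 1) := by field_simp
    _ = ε - ε / 2 ^ M := hgeom M
    _ ≤ ε := by
      have : 0 < ε / 2 ^ M := by positivity
      linarith

/-! ### The union bound -/

namespace MultiDigraph

open Classical in
theorem exists_depth_order {V E : Type*} [Fintype V] (G : MultiDigraph V E) (S : Set V) :
    ∃ idx : V → ℕ, Function.Injective idx ∧ ∀ u v, idx u ≤ idx v → G.depth S u ≤ G.depth S v := by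
  let e := Fintype.equivFin V
  have hlt : ∀ v, (e v : ℕ) < Fintype.card V + 1 := fun v => (e v).2.trans (Nat.lt_succ_self _)
  -- Lexicographic order: depth first, with ties broken by an arbitrary numbering.
  refine ⟨fun v => G.depth S v * (Fintype.card V + 1) + e v, fun u v huv => ?_, fun u v huv => ?_⟩
  · have h1 := congrArg (· % (Fintype.card V + 1)) huv
    simp only [Nat.mul_add_mod_self_right, Nat.mod_eq_of_lt (hlt _)] at h1
    exact e.injective (Fin.ext h1)
  · have h1 := Nat.div_le_div_right (c := Fintype.card V + 1) huv
    have h2 : ∀ v, (G.depth S v * (Fintype.card V + 1) + e v) / (Fintype.card V + 1) =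
        G.depth S v := fun v => by
      rw [add_comm, Nat.add_mul_div_right _ _ (Nat.succ_pos _), Nat.div_eq_of_lt (hlt v), zero_add]
    simpa only [h2] using h1

variable {V E ι F : Type*} {G : MultiDigraph V E} [Field F] [Fintype V] [Fintype E] [Fintype ι]
  {src : ι → V}

open Classical in
/-- If the coefficients of each coding node are drawn uniformly from sufficiently large sets, then
with high probability every set of nodes that is well connected to the sources can recover the
messages. -/
theorem exists_bad_set (hG : G.Acyclic) (hinj : Function.Injective src)
    (hin : ∀ v, {e | G.head e = v}.ncard ≤ 2) (hout : ∀ v, {e | G.tail e = v}.ncard ≤ 2)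
    (hsrc : ∀ e i, G.head e ≠ src i) {ε : ℝ} (hε : 0 < ε) (hR : 1 ≤ Fintype.card ι)
    {B : {e : E // G.IsCodingNode (G.head e)} → Type*} [∀ i, Finite (B i)]
    (val : ∀ i, B i → F) (hval : ∀ i, Function.Injective (val i)) (q : ℕ → ℕ)
    (hqB : ∀ i, Nat.card (B i) = q (G.depth (Set.range src) (G.head i.1)))
    (hq : ∀ Δ, ((Fintype.card ι * 2 ^ (Δ + 1) : ℕ) : ℝ) ^ (Fintype.card ι + 1) * 2 ^ Δ / ε ≤ q Δ)
    (c : (∀ i, B i) → E → F)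
    (hc : ∀ ω e (h : G.IsCodingNode (G.head e)), c ω e = val ⟨e, h⟩ (ω ⟨e, h⟩))
    (hc' : ∀ ω e, ¬ G.IsCodingNode (G.head e) → c ω e = 1) :
    ∃ bad : Set (∀ i, B i), (bad.ncard : ℝ) ≤ ε * Nat.card (∀ i, B i) ∧
      ∀ ω ∉ bad, ∀ (y : V → ι → F), G.IsEncoding src (c ω) y → ∀ A : Set V,
        (∀ C : Finset V, (∀ v ∈ A, ¬ G.Reach src C v) → Fintype.card ι ≤ C.card) →
        ∀ X : ι → F, (∀ v ∈ A, y v ⬝ᵥ X = 0) → X = 0 := by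
  set S := Set.range src with hS
  have hScard : S.ncard = Fintype.card ι := by
    rw [hS, ← Set.image_univ, Set.ncard_image_of_injective _ hinj, Set.ncard_univ,
      Nat.card_eq_fintype_card]
  -- Unreachable coding nodes are never fixed: their conventional depth 0 would spoil the count by
  -- layers.
  set N := G.reachableCoding S with hN
  obtain ⟨idx, hidx, hdepth⟩ := exists_depth_order G S
  have : Nonempty (ι → V) := ⟨src⟩
  -- One enumeration per set, so that the union bound runs over sets of nodes and not over tuples.
  choose! enum henum using exists_enum (V := V) (ι := ι)
  have hNS : ∀ v ∈ N, v ∉ Set.range src := by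
    rintro v ⟨hcod, -⟩ ⟨i, rfl⟩
    obtain ⟨e₁, e₂, -, he⟩ := Set.ncard_eq_two.1 hcod
    exact hsrc e₁ i (he ▸ Set.mem_insert e₁ {e₂} : e₁ ∈ {e | G.head e = src i})
  let ev : V → Finset V → Set (∀ i, B i) := fun v T =>
    {ω | (G.equationMatrix src (G.mixedCoeff F {u | u ∈ N ∧ idx u < idx v} (c ω)) (enum T)).det ≠ 0
      ∧ (G.equationMatrix src (G.mixedCoeff F (insert v {u | u ∈ N ∧ idx u < idx v}) (c ω))
        (enum T)).det = 0}
  let W : V → Finset V := fun v => (G.window S (G.depth S v)).toFinset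
  refine ⟨⋃ v ∈ N.toFinset, ⋃ T ∈ (W v).powersetCard (Fintype.card ι), ev v T, ?_, ?_⟩
  · have hqpos : ∀ Δ, (0 : ℝ) < q Δ := fun Δ =>
      lt_of_lt_of_le (by
        have : 0 < Fintype.card ι * 2 ^ (Δ + 1) := Nat.mul_pos hR (by positivity)
        positivity) (hq Δ)
    have hev : ∀ v ∈ N, ∀ T, ((ev v T).ncard : ℝ) ≤
        Nat.card (∀ i, B i) / q (G.depth S v) := by
      intro v hv T
      rw [le_div_iff₀ (hqpos _)]
      exact_mod_cast card_dependent_mul_le (P := {u | u ∈ N ∧ idx u < idx v}) hv.1 (hNS v hv)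
        (enum T) val hval (q (G.depth S v)) (fun i hi => by rw [hqB, hi]) c hc
    calc ((⋃ v ∈ N.toFinset, ⋃ T ∈ (W v).powersetCard (Fintype.card ι), ev v T).ncard : ℝ)
        ≤ ∑ v ∈ N.toFinset, ∑ T ∈ (W v).powersetCard (Fintype.card ι), ((ev v T).ncard : ℝ) := by
          exact_mod_cast (Finset.set_ncard_biUnion_le _ _).trans
            (Finset.sum_le_sum fun v _ => Finset.set_ncard_biUnion_le _ _)
      _ ≤ ∑ v ∈ N.toFinset, ∑ T ∈ (W v).powersetCard (Fintype.card ι),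
            (Nat.card (∀ i, B i) / q (G.depth S v) : ℝ) :=
          Finset.sum_le_sum fun v hv => Finset.sum_le_sum fun T _ =>
            hev v (Set.mem_toFinset.1 hv) T
      _ = ∑ v ∈ N.toFinset, (((W v).card.choose (Fintype.card ι) : ℝ) / q (G.depth S v)) *
            Nat.card (∀ i, B i) := by
          refine Finset.sum_congr rfl fun v _ => ?_
          rw [Finset.sum_const, Finset.card_powersetCard, nsmul_eq_mul]
          ring
      _ ≤ ∑ v ∈ N.toFinset, (ε / (Fintype.card ι * 2 ^ G.depth S v * 2 ^ G.depth S v)) *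
            Nat.card (∀ i, B i) := by
          refine Finset.sum_le_sum fun v _ => mul_le_mul_of_nonneg_right ?_ (Nat.cast_nonneg _)
          refine choose_div_le hε hR ?_ (hq _)
          rw [← Set.ncard_eq_toFinset_card', ← hScard]
          exact ncard_window_le hout (by rintro e ⟨i, hi⟩; exact hsrc e i hi.symm) _
      _ ≤ ε * Nat.card (∀ i, B i) := by
          rw [← Finset.sum_mul]
          refine mul_le_mul_of_nonneg_right (sum_depth_le hε hR _ _ ?_ ?_) (Nat.cast_nonneg _)
          · intro v hv h0
            obtain ⟨n, hn⟩ := (Set.mem_toFinset.1 hv).2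
            have := mem_layer_depth hn
            rw [h0, layer_zero] at this
            exact hNS v (Set.mem_toFinset.1 hv) this
          · intro k
            rw [← hScard]
            refine le_trans ?_ (ncard_layer_le hout k)
            rw [Set.ncard_eq_toFinset_card']
            refine Finset.card_le_card fun v hv => ?_
            obtain ⟨hv1, rfl⟩ := Finset.mem_filter.1 hv
            obtain ⟨n, hn⟩ := (Set.mem_toFinset.1 hv1).2
            exact Set.mem_toFinset.2 (mem_layer_depth hn)
  · intro ω hω y hy A hconn X hX
    obtain ⟨K, hK⟩ : ∃ K, ∀ v, idx v < K :=
      ⟨Finset.univ.sup idx + 1, fun v => Nat.lt_succ_of_le (Finset.le_sup (Finset.mem_univ v))⟩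
    obtain ⟨y', hy'⟩ := hG.exists_isEncoding hinj (G.mixedCoeff F N (c ω))
    have hNK : {u | u ∈ N ∧ idx u < K} = N := by
      ext u
      exact ⟨fun h => h.1, fun h => ⟨h, hK u⟩⟩
    refine hy.eq_zero_of_hasTightCut hG (x := c ω) (fun _ _ => rfl) (hc' ω) hy'
      (hasTightCut_of_forall_det hG hinj hin hsrc (N := N) hidx.injOn
        (fun v => G.window S (G.depth S v)) (fun v _ u hu => .inl (.inl hu)) ?_ enum henum (c ω)
        ?_ K (by rwa [hNK]) A) hconn hX
    · intro v hv u hu huv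
      exact ⟨.inl (.inr ⟨hu, hdepth _ _ huv⟩), fun e he =>
        .inr ⟨e, rfl, he ▸ hu, he ▸ hdepth _ _ huv⟩⟩
    · intro v hv T hT hTcard h1 h2
      refine hω (Set.mem_biUnion (x := v) (by simpa using hv)
        (Set.mem_biUnion (x := T) (Finset.mem_coe.2 (Finset.mem_powersetCard.2
          ⟨fun w hw => Set.mem_toFinset.2 (hT hw), hTcard⟩)) ⟨h1, h2⟩))

end MultiDigraph

/-! ### Degrees, separating sets and packets in the virtual graph -/

namespace Gadgets

variable {V E : Type*} {N : Network V E} {R : ℕ} (Γ : Gadgets N R)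

instance [Finite E] : Finite Γ.Node := by
  let f : (Σ p, (Γ.inTree p).Node) ⊕ (Σ e, (Γ.outTree e).Node) → Γ.Node
    | .inl ⟨p, x⟩ => .inn p x
    | .inr ⟨e, x⟩ => .out e x
  refine Finite.of_surjective f ?_
  rintro (⟨p, x⟩ | ⟨e, x⟩)
  · exact ⟨.inl ⟨p, x⟩, rfl⟩
  · exact ⟨.inr ⟨e, x⟩, rfl⟩

variable {Γ} in
theorem Node.inn_ne_out {p : Fin R ⊕ E} {x : (Γ.inTree p).Node} {e : E} {y : (Γ.outTree e).Node} :
    Node.inn p x ≠ Node.out e y := nofun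

variable {Γ} in
theorem Node.out_ne_inn {p : Fin R ⊕ E} {x : (Γ.inTree p).Node} {e : E} {y : (Γ.outTree e).Node} :
    Node.out e y ≠ Node.inn p x := nofun

theorem src_injective : Function.Injective Γ.src := by
  intro i j hij
  have h := (Node.inn.inj hij).1
  exact Sum.inl_injective h

theorem head_ne_src (e : Γ.Edge) (i : Fin R) : Γ.graph.head e ≠ Γ.src i := by
  rintro h
  rcases e with e | ⟨p, x⟩ | ⟨e, x⟩ | ⟨p, e, h'⟩
  · have := (Node.inn.inj h).1
    simp at this
  · obtain ⟨rfl, h2⟩ := Node.inn.inj h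
    exact x.2 (eq_of_heq h2)
  · exact (Node.out_ne_inn h).elim
  · exact (Node.out_ne_inn h).elim

/-- Only inner nodes of inverted trees can have two incoming edges. A leaf there receives at most
its connecting edge, because the labelling is injective. -/
theorem ncard_in_le [Finite E] (v : Γ.Node) : {e | Γ.graph.head e = v}.ncard ≤ 2 := by
  have hone : ∀ e₀, {e | Γ.graph.head e = v} ⊆ {e₀} → {e | Γ.graph.head e = v}.ncard ≤ 2 :=
    fun e₀ h => (Set.ncard_le_ncard h (Set.toFinite _)).trans (by simp)
  rcases v with ⟨p, x⟩ | ⟨e, x⟩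
  · by_cases hx : x = (Γ.inTree p).root
    · rcases p with i | e
      · have : {e | Γ.graph.head e = Node.inn (Sum.inl i) x} = ∅ := by
          ext e
          rw [hx]
          exact iff_of_false (Γ.head_ne_src e i) id
        rw [this]
        simp
      · refine hone (.link e) ?_
        rintro (e' | ⟨p', x'⟩ | ⟨e', x'⟩ | ⟨p', e', h'⟩) h
        · have := (Node.inn.inj h).1
          simp at this
          simp [this]
        · obtain ⟨rfl, h2⟩ := Node.inn.inj h
          exact absurd ((eq_of_heq h2).trans hx) x'.2
        · exact (Node.out_ne_inn h).elim
        · exact (Node.out_ne_inn h).elim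
    · refine hone (.down p ⟨x, hx⟩) ?_
      rintro (e' | ⟨p', x'⟩ | ⟨e', x'⟩ | ⟨p', e', h'⟩) h
      · obtain ⟨rfl, h2⟩ := Node.inn.inj h
        exact absurd (eq_of_heq h2).symm hx
      · obtain ⟨rfl, h2⟩ := Node.inn.inj h
        obtain rfl := eq_of_heq h2
        rfl
      · exact (Node.out_ne_inn h).elim
      · exact (Node.out_ne_inn h).elim
  · by_cases hx : ∃ y, (Γ.outTree e).parent y = x
    · have hsub : {e' | Γ.graph.head e' = Node.out e x} ⊆
          Edge.up e '' {y | (Γ.outTree e).parent y = x} := by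
        rintro (e' | ⟨p', x'⟩ | ⟨e', x'⟩ | ⟨p', e', h'⟩) h
        · exact (Node.inn_ne_out h).elim
        · exact (Node.inn_ne_out h).elim
        · obtain ⟨rfl, h2⟩ := Node.out.inj h
          exact ⟨x', eq_of_heq h2, rfl⟩
        · obtain ⟨rfl, h2⟩ := Node.out.inj h
          obtain ⟨y, hy⟩ := hx
          exact absurd (hy.trans (eq_of_heq h2).symm) (((Γ.outTree e').leaf _).2 y)
      exact ((Set.ncard_le_ncard hsub (Set.toFinite _)).trans
        (Set.ncard_image_le (Set.toFinite _))).trans ((Γ.outTree e).binary x)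
    · push Not at hx
      obtain ⟨l, hl⟩ := (Γ.outTree e).leaf.surjective ⟨x, hx⟩
      have hno : ∀ e', Γ.graph.head e' = Node.out e x →
          ∃ (p : Fin R ⊕ E) (h : N.tail e = N.portHead p), e' = .conn p e h ∧
            l = some ⟨p, h.symm⟩ := by
        rintro (e' | ⟨p', x'⟩ | ⟨e', x'⟩ | ⟨p', e', h'⟩) h
        · exact (Node.inn_ne_out h).elim
        · exact (Node.inn_ne_out h).elim
        · obtain ⟨rfl, h2⟩ := Node.out.inj h
          exact absurd (eq_of_heq h2) (hx x')
        · obtain ⟨rfl, h2⟩ := Node.out.inj h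
          refine ⟨p', h', rfl, ?_⟩
          refine (Γ.outTree e').leaf.injective (hl.trans (Subtype.ext ?_))
          exact (eq_of_heq h2).symm
      rcases l with _ | ⟨p, hp⟩
      · have : {e' | Γ.graph.head e' = Node.out e x} = ∅ := by
          ext e'
          refine iff_of_false (fun h => ?_) id
          obtain ⟨p, h, -, h'⟩ := hno e' h
          cases h'
        rw [this]
        simp
      · refine hone (.conn p e hp.symm) fun e' he' => ?_
        obtain ⟨p', h, rfl, h'⟩ := hno e' he'
        cases h'
        rfl

theorem ncard_out_le [Finite E] (v : Γ.Node) : {e | Γ.graph.tail e = v}.ncard ≤ 2 := by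
  have hone : ∀ e₀, {e | Γ.graph.tail e = v} ⊆ {e₀} → {e | Γ.graph.tail e = v}.ncard ≤ 2 :=
    fun e₀ h => (Set.ncard_le_ncard h (Set.toFinite _)).trans (by simp)
  rcases v with ⟨p, x⟩ | ⟨e, x⟩
  · by_cases hx : ∃ y, (Γ.inTree p).parent y = x
    · have hsub : {e' | Γ.graph.tail e' = Node.inn p x} ⊆
          Edge.down p '' {y | (Γ.inTree p).parent y = x} := by
        rintro (e' | ⟨p', x'⟩ | ⟨e', x'⟩ | ⟨p', e', h'⟩) h
        · exact (Node.out_ne_inn h).elim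
        · obtain ⟨rfl, h2⟩ := Node.inn.inj h
          exact ⟨x', eq_of_heq h2, rfl⟩
        · exact (Node.out_ne_inn h).elim
        · obtain ⟨rfl, h2⟩ := Node.inn.inj h
          obtain ⟨y, hy⟩ := hx
          exact absurd (hy.trans (eq_of_heq h2).symm) (((Γ.inTree p').leaf _).2 y)
      exact ((Set.ncard_le_ncard hsub (Set.toFinite _)).trans
        (Set.ncard_image_le (Set.toFinite _))).trans ((Γ.inTree p).binary x)
    · push Not at hx
      obtain ⟨l, hl⟩ := (Γ.inTree p).leaf.surjective ⟨x, hx⟩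
      have hno : ∀ e', Γ.graph.tail e' = Node.inn p x →
          ∃ (e : E) (h : N.tail e = N.portHead p), e' = .conn p e h ∧ l = some ⟨e, h⟩ := by
        rintro (e' | ⟨p', x'⟩ | ⟨e', x'⟩ | ⟨p', e', h'⟩) h
        · exact (Node.out_ne_inn h).elim
        · obtain ⟨rfl, h2⟩ := Node.inn.inj h
          exact absurd (eq_of_heq h2) (hx x')
        · exact (Node.out_ne_inn h).elim
        · obtain ⟨rfl, h2⟩ := Node.inn.inj h
          refine ⟨e', h', rfl, ?_⟩
          refine (Γ.inTree p').leaf.injective (hl.trans (Subtype.ext ?_))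
          exact (eq_of_heq h2).symm
      rcases l with _ | ⟨e, he⟩
      · have : {e' | Γ.graph.tail e' = Node.inn p x} = ∅ := by
          ext e'
          refine iff_of_false (fun h => ?_) id
          obtain ⟨p, h, -, h'⟩ := hno e' h
          cases h'
        rw [this]
        simp
      · refine hone (.conn p e he) fun e' he' => ?_
        obtain ⟨p', h, rfl, h'⟩ := hno e' he'
        cases h'
        rfl
  · by_cases hx : x = (Γ.outTree e).root
    · refine hone (.link e) ?_
      rintro (e' | ⟨p', x'⟩ | ⟨e', x'⟩ | ⟨p', e', h'⟩) h
      · obtain ⟨rfl, -⟩ := Node.out.inj h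
        rfl
      · exact (Node.inn_ne_out h).elim
      · obtain ⟨rfl, h2⟩ := Node.out.inj h
        exact absurd ((eq_of_heq h2).trans hx) x'.2
      · exact (Node.inn_ne_out h).elim
    · refine hone (.up e ⟨x, hx⟩) ?_
      rintro (e' | ⟨p', x'⟩ | ⟨e', x'⟩ | ⟨p', e', h'⟩) h
      · obtain ⟨rfl, h2⟩ := Node.out.inj h
        exact absurd (eq_of_heq h2).symm hx
      · exact (Node.inn_ne_out h).elim
      · obtain ⟨rfl, h2⟩ := Node.out.inj h
        obtain rfl := eq_of_heq h2
        rfl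
      · exact (Node.inn_ne_out h).elim

/-- The input port or link to whose tree a node belongs. -/
def Node.port {Γ : Gadgets N R} : Γ.Node → Fin R ⊕ E
  | .inn p _ => p
  | .out e _ => .inr e

variable {Γ}

theorem reach_inn {C : Set Γ.Node} {p : Fin R ⊕ E} (hp : ∀ c ∈ C, c.port ≠ p)
    (h : Γ.graph.Reach Γ.src C (.inn p (Γ.inTree p).root)) (x : (Γ.inTree p).Node) :
    Γ.graph.Reach Γ.src C (.inn p x) := by
  induction hn : (Γ.inTree p).level x using Nat.strong_induction_on generalizing x with
  | _ n ih =>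
    by_cases hx : x = (Γ.inTree p).root
    · rwa [hx]
    · have hlev := (Γ.inTree p).level_parent ⟨x, hx⟩
      exact .step (G := Γ.graph) (.down p ⟨x, hx⟩)
        (ih _ (by simp only at hlev; omega) _ rfl) fun hC => hp _ hC rfl

theorem reach_out {C : Set Γ.Node} {e : E} (he : ∀ c ∈ C, c.port ≠ .inr e)
    (x : (Γ.outTree e).Node) (h : Γ.graph.Reach Γ.src C (.out e x)) :
    Γ.graph.Reach Γ.src C (.out e (Γ.outTree e).root) := by
  induction hn : (Γ.outTree e).level x using Nat.strong_induction_on generalizing x with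
  | _ n ih =>
    by_cases hx : x = (Γ.outTree e).root
    · rwa [← hx]
    · have hlev := (Γ.outTree e).level_parent ⟨x, hx⟩
      exact ih _ (by simp only at hlev; omega) _
        (.step (G := Γ.graph) (.up e ⟨x, hx⟩) h fun hC => he _ hC rfl) rfl

/-- A set of nodes of the virtual graph that separates a sink from the copies of the source is at
least as large as the number of messages. -/
theorem le_card_of_not_reach [Finite V] [Finite E] (hC : (R : ℕ∞) ≤ N.capacity) {t : V}
    (ht : t ∈ N.sinks) (C : Finset Γ.Node)
    (hsep : ∀ v ∈ {v | ∃ e, N.head e = t ∧ v = Node.out e (Γ.outTree e).root},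
      ¬ Γ.graph.Reach Γ.src C v) : R ≤ C.card := by
  classical
  by_contra! hlt
  -- A node of `C` blocks at most the port to whose tree it belongs; both trees of a link count as
  -- the same port. Fewer than `R` ports are blocked, so some message port is free.
  set H : Finset (Fin R ⊕ E) := C.image Node.port with hH
  have hHcard : H.card < R := Finset.card_image_le.trans_lt hlt
  have hport : ∀ p ∉ H, ∀ c ∈ (C : Set Γ.Node), c.port ≠ p := by
    rintro p hp c hc rfl
    exact hp (Finset.mem_image_of_mem _ hc)
  obtain ⟨i, hi⟩ : ∃ i : Fin R, Sum.inl i ∉ H := by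
    by_contra! hall
    have := Finset.card_le_card_of_injOn (s := (Finset.univ : Finset (Fin R))) (t := H)
      (fun i => Sum.inl i) (fun i _ => hall i) Sum.inl_injective.injOn
    simp at this
    omega
  -- The nodes reached from the source along unblocked links. All links leaving `A` are blocked, so
  -- there are fewer than `R` of them, while the separation keeps `t` outside `A`.
  let A : Set V := {v | Relation.ReflTransGen
    (fun u w => ∃ e, N.tail e = u ∧ N.head e = w ∧ Sum.inr e ∉ H) N.source v}
  have hA : ∀ v ∈ A, (∃ p, p ∉ H ∧ N.portHead p = v ∧
      Γ.graph.Reach Γ.src C (.inn p (Γ.inTree p).root)) ∧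
      (v = N.source ∨ ∃ e, N.head e = v ∧
        Γ.graph.Reach Γ.src C (.out e (Γ.outTree e).root)) := by
    intro v hv
    induction hv with
    | refl =>
      exact ⟨⟨.inl i, hi, rfl, .source (G := Γ.graph) i fun h => hport _ hi _ h rfl⟩, .inl rfl⟩
    | tail _ hstep ih =>
      obtain ⟨e, he, rfl, heH⟩ := hstep
      obtain ⟨⟨p, hp, hpv, hreach⟩, -⟩ := ih
      have hep : N.tail e = N.portHead p := he.trans hpv.symm
      have h1 := reach_inn (hport p hp) hreach ((Γ.inTree p).leaf (some ⟨e, hep⟩))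
      have h2 : Γ.graph.Reach Γ.src C (.out e ((Γ.outTree e).leaf (some ⟨p, hep.symm⟩))) :=
        .step (G := Γ.graph) (.conn p e hep) h1 fun h => hport _ heH _ h rfl
      have h3 := reach_out (hport _ heH) _ h2
      exact ⟨⟨.inr e, heH, rfl, .step (G := Γ.graph) (.link e) h3 fun h => hport _ heH _ h rfl⟩,
        .inr ⟨e, rfl, h3⟩⟩
  have htA : t ∉ A := by
    intro htA
    rcases (hA t htA).2 with rfl | ⟨e, he, hreach⟩
    · exact N.source_notMem_sinks ht
    · exact hsep _ ⟨e, he, rfl⟩ hreach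
  have hcut : N.cut A ⊆ Sum.inr ⁻¹' (H : Set (Fin R ⊕ E)) := by
    rintro e ⟨he, he'⟩
    by_contra heH
    exact he' (Relation.ReflTransGen.tail he ⟨e, rfl, rfl, heH⟩)
  have h1 : N.capacity ≤ (N.cut A).encard :=
    (iInf₂_le t ht).trans (iInf₂_le A ⟨Relation.ReflTransGen.refl, htA⟩)
  have h2 : (N.cut A).encard ≤ H.card := by
    refine (Set.encard_le_encard hcut).trans ?_
    rw [← Set.encard_coe_eq_coe_finsetCard]
    rw [← Sum.inr_injective.encard_image]
    exact Set.encard_le_encard (Set.image_preimage_subset _ _)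
  have h3 := (hC.trans h1).trans h2
  exact absurd (by exact_mod_cast h3) (not_le.2 hHcard)

/-- A node sends the same packet on all outgoing edges, so the encoding vector of the tail solves
the packet equations, whose solution is unique. -/
theorem packets_eq {K : Type*} [Field K] [Finite V] [Finite E] {c : Γ.Edge → K}
    {y : Γ.Node → Fin R → K} (hy : Γ.graph.IsEncoding Γ.src c y) (i : Fin R) (e : Γ.Edge) :
    MultiDigraph.packets Γ.acyclic_graph Γ.src c (Pi.single i 1) e = y (Γ.graph.tail e) i := by
  classical
  have h := Γ.acyclic_graph.existsUnique_isPackets Γ.src c (Pi.single i 1)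
  refine congrFun (h.unique h.choose_spec.1 (y₂ := fun e => y (Γ.graph.tail e) i) ?_) e
  intro e
  simp only
  by_cases hs : Γ.graph.tail e ∈ Set.range Γ.src
  · obtain ⟨j, hj⟩ := hs
    rw [← hj, hy.source, Finset.sum_eq_zero (s := Finset.univ (α := Γ.Edge)), add_zero]
    · simp only [Γ.src_injective.eq_iff]
      rw [Finset.sum_ite_eq']
      simp [Pi.single_apply, eq_comm]
    · exact fun e' _ => if_neg (Γ.head_ne_src e' j)
  · rw [hy.node _ hs, Finset.sum_eq_zero (s := Finset.univ (α := Fin R)), zero_add,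
      Finset.sum_filter, Finset.sum_apply]
    · refine Finset.sum_congr rfl fun e' _ => ?_
      split_ifs <;> simp
    · exact fun j _ => if_neg fun h => hs ⟨j, h⟩

end Gadgets

/-! ### The error probability -/

theorem theorem2 (ε : ℝ) (hε : 0 < ε) (R : ℕ) (hR : 1 ≤ R)
    {V E : Type*} [Finite V] [Finite E] (N : Network V E) (hC : (R : ℕ∞) ≤ N.capacity)
    (Γ : Gadgets N R) :
    Γ.supErrorProb ε ≤ ENNReal.ofReal ε := by
  classical
  have := Fintype.ofFinite Γ.Node
  obtain ⟨bad, hcard, hbad⟩ := MultiDigraph.exists_bad_set (F := RatFunc (ZMod 2))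
    Γ.acyclic_graph Γ.src_injective Γ.ncard_in_le Γ.ncard_out_le Γ.head_ne_src hε (by simpa using hR)
    (B := fun e => boundedPoly (supDegree ε R (Γ.depth (Γ.graph.head e.1))))
    (fun e b => algebraMap (Polynomial (ZMod 2)) (RatFunc (ZMod 2)) b)
    (fun e => (RatFunc.algebraMap_injective (ZMod 2)).comp Subtype.val_injective)
    (fun Δ => Nat.card (boundedPoly (supDegree ε R Δ))) (fun e => rfl)
    (fun Δ => by simpa using le_card_boundedPoly_supDegree hε hR Δ)
    (fun ω e => Gadgets.coeff (Γ := Γ) (ε := ε) ω e) (fun ω e h => dif_pos h)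
    (fun ω e h => dif_neg h)
  have hsub : {ω : Γ.SupChoice ε | Gadgets.IsError ω} ⊆ bad := by
    rintro ω ⟨t, ht, hinj⟩
    by_contra hω
    refine hinj ?_
    obtain ⟨y, hy⟩ := Γ.acyclic_graph.exists_isEncoding Γ.src_injective (Gadgets.coeff ω)
    intro X X' hXX'
    -- The links entering `t` carry the packets of the roots of their inverted trees, so this set of
    -- roots is what has to have full rank.
    refine sub_eq_zero.1 (hbad ω hω y hy
      {v | ∃ e, N.head e = t ∧ v = Gadgets.Node.out e (Γ.outTree e).root} ?_ (X - X') ?_)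
    · intro C hsep
      simpa using Gadgets.le_card_of_not_reach hC ht C hsep
    · rintro _ ⟨e, he, rfl⟩
      have h1 : (Gadgets.transferMatrix ω t).mulVec (X - X') ⟨e, he⟩ = 0 := by
        rw [Matrix.mulVec_sub, hXX', sub_self, Pi.zero_apply]
      rw [← h1]
      simp only [Matrix.mulVec, Gadgets.transferMatrix, Matrix.of_apply]
      refine congrArg (· ⬝ᵥ (X - X')) ?_
      funext i
      exact (Gadgets.packets_eq hy i (.link e)).symm
  rw [Gadgets.supErrorProb, PMF.toOuterMeasure_uniformOfFintype_apply, ← Nat.card_eq_fintype_card,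
    ← Nat.card_eq_fintype_card, Nat.card_coe_set_eq]
  refine ENNReal.div_le_of_le_mul ?_
  have h1 : ({ω : Γ.SupChoice ε | Gadgets.IsError ω}.ncard : ℝ) ≤ ε * Nat.card (Γ.SupChoice ε) :=
    le_trans (Nat.cast_le.2 (Set.ncard_le_ncard hsub (Set.toFinite _))) hcard
  rw [← ENNReal.ofReal_natCast, ← ENNReal.ofReal_natCast, ← ENNReal.ofReal_mul hε.le]
  exact ENNReal.ofReal_le_ofReal h1
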